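/- Let $T\ge 0$, $n\in\mathbb{N}$, and let $P,Q$ be nonempty compact metric spaces. Let $f:[0,T]\times\mathbb{R}^n\times P\to\mathbb{R}^n$ and $g:[0,T]\times\mathbb{R}^n\times Q\to\mathbb{R}^n$ be continuous, Lipschitz continuous in the phase variable on bounded sets (for every $R$ there is $L$ with $\|f(t,x,u)-f(t,x',u)\|\le L\|x-x'\|$ for all $t\in[0,T]$, $u\in P$, $\|x\|,\|x'\|\le R$, and likewise for $g$), and of sublinear growth ($\|f(t,x,u)\|\le C(1+\|x\|)$ for some constant $C$, and likewise for $g$). Let $\sigma_1,\sigma_2:\mathbb{R}^n\to\mathbb{R}$ be continuous. For $(t_0,x_0)\in[0,T]\times\mathbb{R}^n$ and measurable controls $u:[0,T]\to P$, $v:[0,T]\to Q$, let $x(\cdot,t_0,x_0,u,v):[0,T]\to\mathbb{R}^n$ be the solution of $\dot x(t)=f(t,x(t),u(t))+g(t,x(t),v(t))$, $x(t_0)=x_0$. For $u_*\in P$, $v_*\in Q$ (identified with constant controls) put $$\mathrm{Sol}^1(t_0,x_0;v_*)=\mathrm{cl}\{x(\cdot,t_0,x_0,u,v_*): u \text{ measurable}\},\qquad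 \mathrm{Sol}^2(t_0,x_0;u_*)=\mathrm{cl}\{x(\cdot,t_0,x_0,u_*,v): v \text{ measurable}\},$$ $$\mathrm{Sol}(t_0,x_0)=\mathrm{cl}\{x(\cdot,t_0,x_0,u,v): u,v \text{ measurable}\},$$ where $\mathrm{cl}$ is the closure in $C([0,T],\mathbb{R}^n)$ with uniform convergence. Then there exists an upper semicontinuous multifunction $S:[0,T]\times\mathbb{R}^n\rightrightarrows\mathbb{R}^2$ with closed graph and nonempty values such that (S1) $S(T,x)=\{(\sigma_1(x),\sigma_2(x))\}$ for all $x\in\mathbb{R}^n$; (S2) for all $(t,x)\in[0,T]\times\mathbb{R}^n$, $(J_1,J_2)\in S(t,x)$, $u\in P$ and $t_+\in[t,T]$ there exist $y^2(\cdot)\in\mathrm{Sol}^2(t,x;u)$ and $(J_1',J_2')\in S(t_+,y^2(t_+))$ with $J_1\ge J_1'$; (S3) for all $(t,x)\in[0,T]\times\mathbb{R}^n$, $(J_1,J_2)\in S(t,x)$, $v\in Q$ and $t_+\in[t,T]$ there exist $y^1(\cdot)\in\mathrm{Sol}^1(t,x;v)$ and $(J_1'',J_2'')\in S(t_+,y^1(t_+))$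 with $J_2\ge J_2''$; (S4) for all $(t,x)\in[0,T]\times\mathbb{R}^n$, $(J_1,J_2)\in S(t,x)$ and $t_+\in[t,T]$ there exists $y^{c}(\cdot)\in\mathrm{Sol}(t,x)$ with $(J_1,J_2)\in S(t_+,y^{c}(t_+))$. Here upper semicontinuous means: for every $(t,x)$ and every neighbourhood $O$ of the set $S(t,x)$ one has $S(t',x')\subset O$ for all $(t',x')$ close enough to $(t,x)$. -/

import Mathlib

open Set MeasureTheory

/-- The trajectory `x : [0,T] → ℝⁿ` solves `x' = f(t,x,u(t)) + g(t,x,v(t))`, `x(t₀) = x₀`, on the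
whole of `[0,T]`, in the sense of Carathéodory: the right-hand side along `x` is integrable and
`x(t) = x₀ + ∫_{t₀}^t (f + g)` for every `t ∈ [0,T]`. The function `y` is only an extension of `x`
to the real line, needed to write the integral. -/
def IsMotion {n : ℕ} {P Q : Type*} (T : ℝ)
    (f : ℝ → EuclideanSpace ℝ (Fin n) → P → EuclideanSpace ℝ (Fin n))
    (g : ℝ → EuclideanSpace ℝ (Fin n) → Q → EuclideanSpace ℝ (Fin n))
    (t₀ : Icc (0 : ℝ) T) (x₀ : EuclideanSpace ℝ (Fin n)) (u : ℝ → P) (v : ℝ → Q)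
    (x : C(Icc (0 : ℝ) T, EuclideanSpace ℝ (Fin n))) : Prop :=
  ∃ y : ℝ → EuclideanSpace ℝ (Fin n), (∀ t : Icc (0 : ℝ) T, y t = x t) ∧
    IntervalIntegrable (fun s => f s (y s) (u s) + g s (y s) (v s)) volume 0 T ∧
    ∀ t : Icc (0 : ℝ) T,
      x t = x₀ + ∫ s in (t₀ : ℝ)..(t : ℝ), (f s (y s) (u s) + g s (y s) (v s))

/-- `Sol¹(t₀,x₀;v)`: the closure, in the space `C([0,T],ℝⁿ)` with uniform convergence, of the set of
motions with constant second control `v` and an arbitrary measurable first control. -/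
def Sol₁ {n : ℕ} {P Q : Type*} [MeasurableSpace P] (T : ℝ)
    (f : ℝ → EuclideanSpace ℝ (Fin n) → P → EuclideanSpace ℝ (Fin n))
    (g : ℝ → EuclideanSpace ℝ (Fin n) → Q → EuclideanSpace ℝ (Fin n))
    (t₀ : Icc (0 : ℝ) T) (x₀ : EuclideanSpace ℝ (Fin n)) (v : Q) :
    Set C(Icc (0 : ℝ) T, EuclideanSpace ℝ (Fin n)) :=
  closure {x | ∃ u : ℝ → P, Measurable u ∧ IsMotion T f g t₀ x₀ u (fun _ => v) x}

/-- `Sol²(t₀,x₀;u)`: the closure in `C([0,T],ℝⁿ)` of the set of motions with constant first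
control `u` and an arbitrary measurable second control. -/
def Sol₂ {n : ℕ} {P Q : Type*} [MeasurableSpace Q] (T : ℝ)
    (f : ℝ → EuclideanSpace ℝ (Fin n) → P → EuclideanSpace ℝ (Fin n))
    (g : ℝ → EuclideanSpace ℝ (Fin n) → Q → EuclideanSpace ℝ (Fin n))
    (t₀ : Icc (0 : ℝ) T) (x₀ : EuclideanSpace ℝ (Fin n)) (u : P) :
    Set C(Icc (0 : ℝ) T, EuclideanSpace ℝ (Fin n)) :=
  closure {x | ∃ v : ℝ → Q, Measurable v ∧ IsMotion T f g t₀ x₀ (fun _ => u) v x}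

/-- `Sol(t₀,x₀)`: the closure in `C([0,T],ℝⁿ)` of the set of motions with arbitrary measurable
controls of both players. -/
def Sol {n : ℕ} {P Q : Type*} [MeasurableSpace P] [MeasurableSpace Q] (T : ℝ)
    (f : ℝ → EuclideanSpace ℝ (Fin n) → P → EuclideanSpace ℝ (Fin n))
    (g : ℝ → EuclideanSpace ℝ (Fin n) → Q → EuclideanSpace ℝ (Fin n))
    (t₀ : Icc (0 : ℝ) T) (x₀ : EuclideanSpace ℝ (Fin n)) :
    Set C(Icc (0 : ℝ) T, EuclideanSpace ℝ (Fin n)) :=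
  closure {x | ∃ (u : ℝ → P) (v : ℝ → Q), Measurable u ∧ Measurable v ∧ IsMotion T f g t₀ x₀ u v x}

/-- The standing assumptions on one of the two parts `f : [0,T] × ℝⁿ × P → ℝⁿ` of the dynamics.
The values of `f` at times outside `[0,T]` play no role. -/
structure IsAdmissibleDynamics {n : ℕ} {P : Type*} [TopologicalSpace P] (T : ℝ)
    (f : ℝ → EuclideanSpace ℝ (Fin n) → P → EuclideanSpace ℝ (Fin n)) : Prop where
  /-- `f` is jointly continuous. -/
  continuousOn : ContinuousOn
    (fun p : ℝ × EuclideanSpace ℝ (Fin n) × P => f p.1 p.2.1 p.2.2) (Icc 0 T ×ˢ univ)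
  /-- `f` is Lipschitz in the phase variable, on bounded sets, uniformly in time and control. -/
  lipschitz : ∀ R : ℝ, ∃ L : ℝ, ∀ t ∈ Icc (0 : ℝ) T, ∀ u : P, ∀ x x' : EuclideanSpace ℝ (Fin n),
    ‖x‖ ≤ R → ‖x'‖ ≤ R → ‖f t x u - f t x' u‖ ≤ L * ‖x - x'‖
  /-- `f` has sublinear growth in the phase variable. -/
  growth : ∃ C : ℝ, ∀ t ∈ Icc (0 : ℝ) T, ∀ u : P, ∀ x : EuclideanSpace ℝ (Fin n),
    ‖f t x u‖ ≤ C * (1 + ‖x‖)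

/-- The boundary condition (S1) and the viability conditions (S2), (S3), (S4) for a multifunction
`S : [0,T] × ℝⁿ ⇉ ℝ²`. -/
structure IsValueMultifunction {n : ℕ} {P Q : Type*} [MeasurableSpace P] [MeasurableSpace Q] (T : ℝ)
    (f : ℝ → EuclideanSpace ℝ (Fin n) → P → EuclideanSpace ℝ (Fin n))
    (g : ℝ → EuclideanSpace ℝ (Fin n) → Q → EuclideanSpace ℝ (Fin n))
    (σ₁ σ₂ : EuclideanSpace ℝ (Fin n) → ℝ)
    (S : Icc (0 : ℝ) T × EuclideanSpace ℝ (Fin n) → Set (ℝ × ℝ)) : Prop where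
  S1 : ∀ (t : Icc (0 : ℝ) T) (x : EuclideanSpace ℝ (Fin n)), (t : ℝ) = T →
    S (t, x) = {(σ₁ x, σ₂ x)}
  S2 : ∀ (t : Icc (0 : ℝ) T) (x : EuclideanSpace ℝ (Fin n)), ∀ J ∈ S (t, x), ∀ u : P,
    ∀ t' : Icc (0 : ℝ) T, t ≤ t' →
      ∃ y ∈ Sol₂ T f g t x u, ∃ J' ∈ S (t', y t'), J.1 ≥ J'.1
  S3 : ∀ (t : Icc (0 : ℝ) T) (x : EuclideanSpace ℝ (Fin n)), ∀ J ∈ S (t, x), ∀ v : Q,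
    ∀ t' : Icc (0 : ℝ) T, t ≤ t' →
      ∃ y ∈ Sol₁ T f g t x v, ∃ J' ∈ S (t', y t'), J.2 ≥ J'.2
  S4 : ∀ (t : Icc (0 : ℝ) T) (x : EuclideanSpace ℝ (Fin n)), ∀ J ∈ S (t, x),
    ∀ t' : Icc (0 : ℝ) T, t ≤ t' → ∃ y ∈ Sol T f g t x, J ∈ S (t', y t')

/-! The multifunction is built backwards on finite sets of times, and the sets are then refined.
Suppose that the values at a time `b` are known, with closed graph and bounded over bounded sets. At
an earlier time `a`, let `J` be a value at `x` if some motion carries it unchanged to `b` and, for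
every constant control of one player, some motion under that control ends at a value at `b` whose
coordinate for that player is at most that of `J`. Such `J` exist (`exists_maximin_value`): among
finitely many controls, take for each player the one with the largest guaranteed minimum; any value
reached under this constant pair dominates all these minima. Compactness treats all controls at
once.

Since one kind of motion preserves values up to the terminal time, every value is a terminal payoff.
Values over a bounded set of positions thus lie in a compact set independent of the finite set of
times. Hence the upper limit of the graphs along ever larger finite sets has nonempty values, and
compactness of the motion sets carries the viability conditions to it (`exists_viable`). Closed
graph and local boundedness give upper semicontinuity.

From differential equations one needs Arzelà–Ascoli compactness, which follows from the growth
bound, and stability in the initial data with a constant uniform in the controls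
(`exists_forall_norm_sub_le`); the latter gives closed graphs and concatenation of closure motions.
(S2), (S3), (S4) become one condition indexed by `Option (P ⊕ Q)`, with `none` for (S4). -/

open Filter Topology

/-! ### Integral equations with Carathéodory right-hand sides -/

/-- A right-hand side `h t x` which is measurable in time along continuous curves, Lipschitz in `x`
on balls with constant `L R`, and of linear growth with constant `C`. -/
structure IsCaratheodoryField {E : Type*} [NormedAddCommGroup E] (T C : ℝ) (L : ℝ → ℝ)
    (h : ℝ → E → E) : Prop where
  aestronglyMeasurable : ∀ y : ℝ → E, Continuous y →
    AEStronglyMeasurable (fun s => h s (y s)) (volume.restrict (Icc 0 T))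
  lipschitz : ∀ R, ∀ t ∈ Icc (0 : ℝ) T, ∀ x x' : E, ‖x‖ ≤ R → ‖x'‖ ≤ R →
    ‖h t x - h t x'‖ ≤ L R * ‖x - x'‖
  growth : ∀ t ∈ Icc (0 : ℝ) T, ∀ x : E, ‖h t x‖ ≤ C * (1 + ‖x‖)

/-- The curve `x : [0,T] → E` solves `x' = h(t,x)`, `x(t₀) = x₀` in integral form. -/
def IsIntegralSolution {E : Type*} [NormedAddCommGroup E] [NormedSpace ℝ E] {T : ℝ} (hT : 0 ≤ T)
    (h : ℝ → E → E) (t₀ : Icc (0 : ℝ) T) (x₀ : E) (x : C(Icc (0 : ℝ) T, E)) : Prop :=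
  ∀ t : Icc (0 : ℝ) T, x t = x₀ + ∫ s in (t₀ : ℝ)..t, h s (IccExtend hT x s)

section ODE

variable {E : Type*} [NormedAddCommGroup E] [NormedSpace ℝ E] {T : ℝ}

theorem uIoc_subset_Icc_of_mem (a b : Icc (0 : ℝ) T) : uIoc (a : ℝ) b ⊆ Icc 0 T :=
  uIoc_subset_uIcc.trans (uIcc_subset_Icc a.2 b.2)

/-- The gain `1 / l` drives all weighted estimates below. Both orders of `a` and `b` occur because
motions also run backwards from their initial time. -/
theorem abs_integral_exp_abs_sub_le {l : ℝ} (hl : 0 < l) (a b : ℝ) :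
    |∫ s in a..b, Real.exp (l * |s - a|)| ≤ Real.exp (l * |b - a|) / l := by
  rcases le_total a b with hab | hab
  · have h1 : ∫ s in a..b, Real.exp (l * |s - a|) = ∫ s in a..b, Real.exp (l * (s - a)) := by
      refine intervalIntegral.integral_congr fun s hs => ?_
      rw [uIcc_of_le hab] at hs
      simp only [abs_of_nonneg (sub_nonneg.2 hs.1)]
    have h2 : ∫ s in a..b, Real.exp (l * (s - a)) =
        Real.exp (l * (b - a)) / l - Real.exp (l * (a - a)) / l := by
      refine intervalIntegral.integral_eq_sub_of_hasDerivAt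
        (f := fun s => Real.exp (l * (s - a)) / l) (fun s _ => ?_)
        (Continuous.intervalIntegrable (by fun_prop) _ _)
      have := ((((hasDerivAt_id s).sub_const a).const_mul l).exp).div_const l
      simpa [hl.ne'] using this
    rw [h1, h2, abs_of_nonneg (sub_nonneg.2 hab), abs_of_nonneg]
    · have : 0 < Real.exp (l * (a - a)) / l := by positivity
      linarith
    · have : l * (a - a) ≤ l * (b - a) := by gcongr
      have := Real.exp_le_exp.2 this
      rw [sub_nonneg]
      gcongr
  · have h1 : ∫ s in a..b, Real.exp (l * |s - a|) = ∫ s in a..b, Real.exp (l * (a - s)) := by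
      refine intervalIntegral.integral_congr fun s hs => ?_
      rw [uIcc_of_ge hab] at hs
      simp only [abs_of_nonpos (sub_nonpos.2 hs.2), neg_sub]
    have h2 : ∫ s in a..b, Real.exp (l * (a - s)) =
        -(Real.exp (l * (a - b)) / l) - -(Real.exp (l * (a - a)) / l) := by
      refine intervalIntegral.integral_eq_sub_of_hasDerivAt
        (f := fun s => -(Real.exp (l * (a - s)) / l)) (fun s _ => ?_)
        (Continuous.intervalIntegrable (by fun_prop) _ _)
      have := (((((hasDerivAt_id s).const_sub a).const_mul l).exp).div_const l).neg
      convert this using 1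
      · rfl
      · simp only [id]; field_simp
    rw [h1, h2, abs_of_nonpos (sub_nonpos.2 hab), neg_sub, abs_of_nonpos]
    · have : 0 < Real.exp (l * (a - a)) / l := by positivity
      linarith
    · have : l * (a - a) ≤ l * (a - b) := by gcongr
      have := Real.exp_le_exp.2 this
      have : Real.exp (l * (a - a)) / l ≤ Real.exp (l * (a - b)) / l := by gcongr
      linarith

theorem norm_integral_le_of_norm_le_exp {l K : ℝ} (hl : 0 < l) (hK : 0 ≤ K)
    (a b : Icc (0 : ℝ) T) {φ : ℝ → E}
    (h : ∀ s ∈ Icc (0 : ℝ) T, ‖φ s‖ ≤ K * Real.exp (l * |s - a|)) :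
    ‖∫ s in (a : ℝ)..b, φ s‖ ≤ K / l * Real.exp (l * |(b : ℝ) - a|) := by
  have h1 : ‖∫ s in (a : ℝ)..b, φ s‖ ≤ |∫ s in (a : ℝ)..b, K * Real.exp (l * |s - a|)| := by
    refine intervalIntegral.norm_integral_le_abs_of_norm_le ?_
      (Continuous.intervalIntegrable (by fun_prop) _ _)
    exact (ae_restrict_iff' measurableSet_uIoc).2
      (Filter.Eventually.of_forall fun s hs => h s (uIoc_subset_Icc_of_mem a b hs))
  rw [intervalIntegral.integral_const_mul, abs_mul, abs_of_nonneg hK] at h1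
  refine h1.trans ((mul_le_mul_of_nonneg_left (abs_integral_exp_abs_sub_le hl _ _) hK).trans ?_)
  exact le_of_eq (by ring)

/-- A two-sided Grönwall inequality in integral form. -/
theorem norm_le_of_norm_le_integral {φ : C(Icc (0 : ℝ) T, E)} {ψ : ℝ → E} (t₀ : Icc (0 : ℝ) T)
    {K a b : ℝ} (hK : 0 < K) (hb : 0 ≤ b)
    (h₁ : ∀ s : Icc (0 : ℝ) T, ‖φ s‖ ≤ a + ‖∫ r in (t₀ : ℝ)..s, ψ r‖)
    (h₂ : ∀ r : Icc (0 : ℝ) T, ‖ψ r‖ ≤ K * (b + ‖φ r‖)) (s : Icc (0 : ℝ) T) :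
    ‖φ s‖ ≤ (2 * a + b) * Real.exp (2 * K * T) := by
  have ha : 0 ≤ a := by simpa using (norm_nonneg _).trans (h₁ t₀)
  -- Maximise the weighted norm. With rate `2 * K` the integral contributes at most `(b + m) / 2`
  -- after weighting, so `m ≤ a + (b + m) / 2` and the term in `m` is absorbed.
  obtain ⟨s₁, -, hs₁⟩ := (isCompact_univ (X := Icc (0 : ℝ) T)).exists_isMaxOn ⟨t₀, mem_univ _⟩
    (f := fun s => ‖φ s‖ * Real.exp (-(2 * K * |(s : ℝ) - t₀|))) (by fun_prop)
  set m := ‖φ s₁‖ * Real.exp (-(2 * K * |(s₁ : ℝ) - t₀|)) with hm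
  have hm0 : 0 ≤ m := by positivity
  have hφ : ∀ s, ‖φ s‖ ≤ m * Real.exp (2 * K * |(s : ℝ) - t₀|) := fun s => by
    have : ‖φ s‖ * Real.exp (-(2 * K * |(s : ℝ) - t₀|)) ≤ m := hs₁ (mem_univ s)
    rwa [Real.exp_neg, ← div_eq_mul_inv, div_le_iff₀ (Real.exp_pos _)] at this
  have hψ : ∀ r ∈ Icc (0 : ℝ) T, ‖ψ r‖ ≤ (K * (b + m)) * Real.exp (2 * K * |r - t₀|) := by
    intro r hr
    have h1 : 1 ≤ Real.exp (2 * K * |r - t₀|) := Real.one_le_exp (by positivity)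
    have h2 := hφ ⟨r, hr⟩
    calc ‖ψ r‖ ≤ K * (b + ‖φ ⟨r, hr⟩‖) := h₂ ⟨r, hr⟩
      _ ≤ K * (b * Real.exp (2 * K * |r - t₀|) + m * Real.exp (2 * K * |r - t₀|)) := by
        gcongr
        nlinarith
      _ = _ := by ring
  have hm2 : m ≤ 2 * a + b := by
    have h1 := (h₁ s₁).trans (add_le_add_right
      (norm_integral_le_of_norm_le_exp (by positivity) (by positivity) t₀ s₁ hψ) a)
    have h2 : 1 ≤ Real.exp (2 * K * |(s₁ : ℝ) - t₀|) := Real.one_le_exp (by positivity)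
    have h3 : ‖φ s₁‖ = m * Real.exp (2 * K * |(s₁ : ℝ) - t₀|) := by
      rw [hm, mul_assoc, ← Real.exp_add]; simp
    rw [h3] at h1
    have h4 : K * (b + m) / (2 * K) = (b + m) / 2 := by field_simp
    rw [h4] at h1
    have h5 : (m - (b + m) / 2) * Real.exp (2 * K * |(s₁ : ℝ) - t₀|) ≤ a := by linarith
    by_contra hlt
    push Not at hlt
    nlinarith
  refine (hφ s).trans ?_
  have : |(s : ℝ) - t₀| ≤ T := by
    rw [abs_le]; constructor <;> linarith [s.2.1, s.2.2, t₀.2.1, t₀.2.2]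
  gcongr

variable {C : ℝ} {L : ℝ → ℝ} {h : ℝ → E → E}

omit [NormedSpace ℝ E] in
theorem IsCaratheodoryField.intervalIntegrable (hh : IsCaratheodoryField T C L h)
    {y : ℝ → E} (hy : Continuous y) (a b : Icc (0 : ℝ) T) :
    IntervalIntegrable (fun s => h s (y s)) volume a b := by
  have h1 : IntegrableOn (fun s => h s (y s)) (Icc 0 T) := by
    obtain ⟨M, hM⟩ := (isCompact_Icc (a := (0 : ℝ)) (b := T)).exists_bound_of_continuousOn
      (f := fun s => C * (1 + ‖y s‖)) (by fun_prop)
    have : IsFiniteMeasure (volume.restrict (Icc 0 T)) := ⟨by simp⟩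
    refine Integrable.of_bound (hh.aestronglyMeasurable y hy) M ?_
    exact (ae_restrict_iff' measurableSet_Icc).2 (Filter.Eventually.of_forall fun s hs =>
      (hh.growth s hs _).trans ((le_abs_self _).trans (hM s hs)))
  exact (h1.mono_set (uIcc_subset_Icc a.2 b.2)).intervalIntegrable

theorem IsIntegralSolution.apply_self {hT : 0 ≤ T} {t₀ : Icc (0 : ℝ) T} {x₀ : E}
    {x : C(Icc (0 : ℝ) T, E)} (hx : IsIntegralSolution hT h t₀ x₀ x) : x t₀ = x₀ := by
  simpa using hx t₀

omit [NormedSpace ℝ E] in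
theorem continuous_IccExtend (hT : 0 ≤ T) (x : C(Icc (0 : ℝ) T, E)) :
    Continuous (IccExtend hT x) := x.continuous.Icc_extend'

theorem IsIntegralSolution.sub_eq (hh : IsCaratheodoryField T C L h) {hT : 0 ≤ T}
    {t₀ : Icc (0 : ℝ) T} {x₀ : E} {x : C(Icc (0 : ℝ) T, E)}
    (hx : IsIntegralSolution hT h t₀ x₀ x) (a b : Icc (0 : ℝ) T) :
    x b - x a = ∫ s in (a : ℝ)..b, h s (IccExtend hT x s) := by
  have := continuous_IccExtend hT x
  rw [hx a, hx b, add_sub_add_left_eq_sub, intervalIntegral.integral_interval_sub_left]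
  · exact hh.intervalIntegrable this _ _
  · exact hh.intervalIntegrable this _ _

theorem IsIntegralSolution.rebase (hh : IsCaratheodoryField T C L h) {hT : 0 ≤ T}
    {t₀ : Icc (0 : ℝ) T} {x₀ : E} {x : C(Icc (0 : ℝ) T, E)}
    (hx : IsIntegralSolution hT h t₀ x₀ x) (a : Icc (0 : ℝ) T) :
    IsIntegralSolution hT h a (x a) x := fun b => by
  rw [← hx.sub_eq hh a b]; abel

theorem IsIntegralSolution.norm_le (hC : 0 < C) (hh : IsCaratheodoryField T C L h) {hT : 0 ≤ T}
    {t₀ : Icc (0 : ℝ) T} {x₀ : E} {x : C(Icc (0 : ℝ) T, E)}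
    (hx : IsIntegralSolution hT h t₀ x₀ x) (s : Icc (0 : ℝ) T) :
    ‖x s‖ ≤ (2 * ‖x₀‖ + 1) * Real.exp (2 * C * T) := by
  refine norm_le_of_norm_le_integral t₀ hC zero_le_one
    (ψ := fun s => h s (IccExtend hT x s)) (fun s => ?_) (fun r => ?_) s
  · rw [hx s]; exact norm_add_le _ _
  · simpa [IccExtend_val] using hh.growth r r.2 (IccExtend hT x r)

theorem IsIntegralSolution.norm_sub_le (hC : 0 < C) (hh : IsCaratheodoryField T C L h)
    {hT : 0 ≤ T} {t₀ : Icc (0 : ℝ) T} {x₀ : E} {x : C(Icc (0 : ℝ) T, E)}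
    (hx : IsIntegralSolution hT h t₀ x₀ x) (a b : Icc (0 : ℝ) T) :
    ‖x b - x a‖ ≤ C * (1 + (2 * ‖x₀‖ + 1) * Real.exp (2 * C * T)) * |(b : ℝ) - a| := by
  rw [hx.sub_eq hh a b]
  refine intervalIntegral.norm_integral_le_of_norm_le_const fun s hs => ?_
  have hs' := uIoc_subset_Icc_of_mem a b hs
  refine (hh.growth s hs' _).trans ?_
  rw [IccExtend_of_mem _ _ hs']
  have := hx.norm_le hC hh ⟨s, hs'⟩
  gcongr

/-- Solutions depend on the initial position in a Lipschitz way, locally uniformly. -/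
theorem exists_forall_norm_sub_le (E : Type*) [NormedAddCommGroup E] [NormedSpace ℝ E]
    (hT : 0 ≤ T) (hC : 0 < C) (hL : ∀ R, 0 < L R) (R : ℝ) :
    ∃ K : ℝ, 0 < K ∧ ∀ h : ℝ → E → E, IsCaratheodoryField T C L h →
      ∀ (t t' : Icc (0 : ℝ) T) (x x' : E), ‖x‖ ≤ R → ‖x'‖ ≤ R →
      ∀ y y' : C(Icc (0 : ℝ) T, E), IsIntegralSolution hT h t x y →
        IsIntegralSolution hT h t' x' y' →
        ∀ s, ‖y s - y' s‖ ≤ K * (dist t t' + dist x x') := by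
  set M := (2 * R + 1) * Real.exp (2 * C * T) with hM
  set B := |C * (1 + M)| + 1 with hB
  have hB1 : 1 ≤ B := by rw [hB]; linarith [abs_nonneg (C * (1 + M))]
  -- `M` bounds both solutions and `B` bounds their speed, so at time `t` they differ by at most `B`
  -- times the distance of the data; Grönwall with rate `L M` supplies the rest. Nothing depends on
  -- the individual field `h`.
  refine ⟨2 * B * Real.exp (2 * L M * T), by positivity, ?_⟩
  intro h hh t t' x x' hx hx' y y' hy hy' s
  have hyM : ∀ s, ‖y s‖ ≤ M := fun s => (hy.norm_le hC hh s).trans (by rw [hM]; gcongr)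
  have hyM' : ∀ s, ‖y' s‖ ≤ M := fun s => (hy'.norm_le hC hh s).trans (by rw [hM]; gcongr)
  have h1 : ‖x - y' t‖ ≤ B * (dist t t' + dist x x') := by
    have h2 := hy'.norm_sub_le hC hh t' t
    rw [hy'.apply_self] at h2
    have h3 : ‖y' t - x'‖ ≤ B * dist t t' := by
      rw [Subtype.dist_eq, Real.dist_eq]
      refine h2.trans ?_
      gcongr
      calc C * (1 + (2 * ‖x'‖ + 1) * Real.exp (2 * C * T)) ≤ C * (1 + M) := by rw [hM]; gcongr
        _ ≤ B := (le_abs_self _).trans (by linarith)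
    calc ‖x - y' t‖ = ‖(x - x') - (y' t - x')‖ := by congr 1; abel
      _ ≤ ‖x - x'‖ + ‖y' t - x'‖ := _root_.norm_sub_le _ _
      _ ≤ 1 * dist x x' + B * dist t t' := by rw [one_mul, dist_eq_norm x x']; gcongr
      _ ≤ B * dist x x' + B * dist t t' := by gcongr
      _ = _ := by ring
  have key := norm_le_of_norm_le_integral (φ := y - y') t (hL M) le_rfl (a := ‖x - y' t‖)
    (ψ := fun s => h s (IccExtend hT y s) - h s (IccExtend hT y' s)) (fun s => ?_) (fun r => ?_) s
  · refine key.trans ?_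
    rw [add_zero]
    calc 2 * ‖x - y' t‖ * Real.exp (2 * L M * T)
        ≤ 2 * (B * (dist t t' + dist x x')) * Real.exp (2 * L M * T) := by gcongr
      _ = _ := by ring
  · have h4 := hy s
    have h5 := hy'.rebase hh t s
    rw [intervalIntegral.integral_sub (hh.intervalIntegrable (continuous_IccExtend hT y) _ _)
      (hh.intervalIntegrable (continuous_IccExtend hT y') _ _)]
    calc ‖(y - y') s‖ = ‖(x - y' t) + ((∫ s in (t : ℝ)..s, h s (IccExtend hT y s)) -
          ∫ s in (t : ℝ)..s, h s (IccExtend hT y' s))‖ := by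
          rw [ContinuousMap.sub_apply, h4, h5]; congr 1; abel
      _ ≤ _ := norm_add_le _ _
  · rw [IccExtend_val, IccExtend_val, zero_add]
    exact hh.lipschitz M r r.2 _ _ (hyM r) (hyM' r)

end ODE

/-! ### Global existence and switching between fields -/

section ODE

variable {E : Type*} [NormedAddCommGroup E] [NormedSpace ℝ E] {T C : ℝ} {L : ℝ → ℝ} {h : ℝ → E → E}

/-- Global existence for Carathéodory equations: the Picard map is a contraction for an
exponentially weighted norm on a set of curves of controlled growth. -/
theorem IsCaratheodoryField.exists_isIntegralSolution [CompleteSpace E]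
    (hh : IsCaratheodoryField T C L h) (hC : 0 < C) (hL : ∀ R, 0 < L R) (hT : 0 ≤ T)
    (t₀ : Icc (0 : ℝ) T) (x₀ : E) : ∃ x, IsIntegralSolution hT h t₀ x₀ x := by
  -- With rate `3 * C` the integral term is at most `(1 + ‖x₀‖) * exp (m * |s - t₀|)`, so the bound
  -- `r * exp (m * |s - t₀|)` is preserved. It keeps curves in the ball of radius `R`, where `l = 2
  -- * L R` makes the contraction factor `1 / 2`.
  set m := 3 * C with hm
  set r := 2 * (1 + ‖x₀‖) with hr
  set R := r * Real.exp (m * T) with hR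
  set l := 2 * L R with hl
  have hl0 : 0 < l := by have := hL R; positivity
  -- The unknown is `z = w⁻¹ • x`, so that the ordinary uniform distance of the `z` is the weighted
  -- distance of the curves `x`.
  let w : C(Icc (0 : ℝ) T, ℝ) := ⟨fun s => Real.exp (l * |(s : ℝ) - t₀|), by fun_prop⟩
  have hw : ∀ s, 0 < w s := fun s => Real.exp_pos _
  have habs : ∀ s ∈ Icc (0 : ℝ) T, |s - t₀| ≤ T := fun s hs => by
    rw [abs_le]; constructor <;> linarith [hs.1, hs.2, t₀.2.1, t₀.2.2]
  let D : Set C(Icc (0 : ℝ) T, E) := {z | ∀ s, ‖w s • z s‖ ≤ r * Real.exp (m * |(s : ℝ) - t₀|)}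
  have hD : IsClosed D := by
    simp only [D, ofPred_forall]
    exact isClosed_iInter fun s => isClosed_le (by fun_prop) continuous_const
  have hDR : ∀ z ∈ D, ∀ s, ‖w s • z s‖ ≤ R := fun z hz s => (hz s).trans (by
    rw [hR]
    have := habs s s.2
    gcongr)
  let c : C(Icc (0 : ℝ) T, E) → C(Icc (0 : ℝ) T, E) := fun z => ⟨fun s => w s • z s, by fun_prop⟩
  let rhs : C(Icc (0 : ℝ) T, E) → ℝ → E := fun z s => h s (IccExtend hT (c z) s)
  have hint : ∀ z (a b : Icc (0 : ℝ) T), IntervalIntegrable (rhs z) volume a b := fun z a b =>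
    hh.intervalIntegrable (continuous_IccExtend hT (c z)) a b
  have hprim : ∀ z, Continuous fun s : Icc (0 : ℝ) T => ∫ q in (t₀ : ℝ)..s, rhs z q := fun z => by
    have h1 := intervalIntegral.continuousOn_primitive_interval' (a := (t₀ : ℝ))
      (hint z ⟨0, le_rfl, hT⟩ ⟨T, hT, le_rfl⟩) (by rw [uIcc_of_le hT]; exact t₀.2)
    rw [uIcc_of_le hT] at h1
    exact continuousOn_iff_continuous_domRestrict.1 h1
  let Φ : C(Icc (0 : ℝ) T, E) → C(Icc (0 : ℝ) T, E) := fun z =>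
    ⟨fun s => (w s)⁻¹ • (x₀ + ∫ q in (t₀ : ℝ)..s, rhs z q),
      (w.continuous.inv₀ fun s => (hw s).ne').smul (continuous_const.add (hprim z))⟩
  have hΦ : ∀ z s, w s • Φ z s = x₀ + ∫ q in (t₀ : ℝ)..s, rhs z q := fun z s =>
    smul_inv_smul₀ (hw s).ne' _
  have hmaps : MapsTo Φ D D := by
    intro z hz s
    rw [hΦ]
    have h1 : ∀ q ∈ Icc (0 : ℝ) T, ‖rhs z q‖ ≤ (C * (3 * (1 + ‖x₀‖))) * Real.exp (m * |q - t₀|) := by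
      intro q hq
      have h2 := hh.growth q hq (IccExtend hT (c z) q)
      rw [IccExtend_of_mem _ _ hq] at h2
      have h3 := hz ⟨q, hq⟩
      have h4 : 1 ≤ Real.exp (m * |q - t₀|) := Real.one_le_exp (by positivity)
      have h5 : 1 + ‖(c z) ⟨q, hq⟩‖ ≤ 3 * (1 + ‖x₀‖) * Real.exp (m * |q - t₀|) := by
        have : (c z) ⟨q, hq⟩ = w ⟨q, hq⟩ • z ⟨q, hq⟩ := rfl
        rw [this]
        rw [hr] at h3
        nlinarith [norm_nonneg x₀]
      simp only [rhs]
      rw [IccExtend_of_mem _ _ hq]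
      refine h2.trans ?_
      rw [mul_assoc]
      gcongr
    have h2 := norm_integral_le_of_norm_le_exp (by positivity) (by positivity) t₀ s h1
    have h3 : C * (3 * (1 + ‖x₀‖)) / m = 1 + ‖x₀‖ := by rw [hm]; field_simp
    rw [h3] at h2
    have h4 : 1 ≤ Real.exp (m * |(s : ℝ) - t₀|) := Real.one_le_exp (by positivity)
    refine (norm_add_le _ _).trans ?_
    rw [hr]
    nlinarith [norm_nonneg x₀]
  have hlip : ∀ z ∈ D, ∀ z' ∈ D, dist (Φ z) (Φ z') ≤ (2⁻¹ : ℝ) * dist z z' := by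
    intro z hz z' hz'
    refine (ContinuousMap.dist_le (by positivity)).2 fun s => ?_
    have h1 : ∀ q ∈ Icc (0 : ℝ) T,
        ‖rhs z q - rhs z' q‖ ≤ (L R * dist z z') * Real.exp (l * |q - t₀|) := by
      intro q hq
      simp only [rhs]
      rw [IccExtend_of_mem _ _ hq, IccExtend_of_mem _ _ hq]
      refine (hh.lipschitz R q hq _ _ (hDR z hz _) (hDR z' hz' _)).trans ?_
      have h2 : (c z) ⟨q, hq⟩ - (c z') ⟨q, hq⟩ = w ⟨q, hq⟩ • (z ⟨q, hq⟩ - z' ⟨q, hq⟩) :=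
        (smul_sub _ _ _).symm
      change L R * ‖(c z) ⟨q, hq⟩ - (c z') ⟨q, hq⟩‖ ≤ _
      rw [h2, norm_smul, Real.norm_of_nonneg (hw _).le, ← dist_eq_norm, mul_comm (w _), mul_assoc]
      have := z.dist_apply_le_dist (g := z') ⟨q, hq⟩
      have : 0 ≤ w ⟨q, hq⟩ := (hw _).le
      exact mul_le_mul_of_nonneg_left (by gcongr; rfl) (hL R).le
    have h2 := norm_integral_le_of_norm_le_exp hl0
      (mul_nonneg (hL R).le dist_nonneg) t₀ s h1
    rw [intervalIntegral.integral_sub (hint _ _ _) (hint _ _ _)] at h2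
    have h3 : Φ z s - Φ z' s =
        (w s)⁻¹ • ((∫ q in (t₀ : ℝ)..s, rhs z q) - ∫ q in (t₀ : ℝ)..s, rhs z' q) := by
      change (w s)⁻¹ • (x₀ + ∫ q in (t₀ : ℝ)..s, rhs z q) -
        (w s)⁻¹ • (x₀ + ∫ q in (t₀ : ℝ)..s, rhs z' q) = _
      rw [← smul_sub, add_sub_add_left_eq_sub]
    have h4 : L R * dist z z' / l = 2⁻¹ * dist z z' := by
      have := (hL R).ne'
      rw [hl]; field_simp
    rw [h4] at h2
    rw [dist_eq_norm, h3, norm_smul, norm_inv, Real.norm_of_nonneg (hw s).le,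
      inv_mul_le_iff₀ (hw s), mul_comm (w s)]
    exact h2
  have hcontr : ContractingWith (2⁻¹ : NNReal) (hmaps.restrict Φ D D) := by
    refine ⟨by rw [← NNReal.coe_lt_coe]; norm_num, LipschitzWith.of_dist_le_mul fun z z' => ?_⟩
    simpa [Subtype.dist_eq] using hlip z z.2 z' z'.2
  have h0 : (0 : C(Icc (0 : ℝ) T, E)) ∈ D := fun s => by
    simp only [ContinuousMap.zero_apply, smul_zero, norm_zero]; positivity
  obtain ⟨z, hzD, hz, -⟩ := hcontr.exists_fixedPoint' hD.isComplete hmaps h0 (edist_ne_top _ _)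
  refine ⟨c z, fun s => ?_⟩
  have := hΦ z s
  rw [hz] at this
  exact this

omit [NormedSpace ℝ E] in
/-- Switching from one admissible curve to another one at a time at which they meet. -/
theorem exists_glue (b : Icc (0 : ℝ) T) (y z : C(Icc (0 : ℝ) T, E)) (hyz : y b = z b) :
    ∃ w : C(Icc (0 : ℝ) T, E), ∀ s, w s = if s ≤ b then y s else z s :=
  ⟨⟨fun s => if s ≤ b then y s else z s, y.continuous.if_le z.continuous continuous_id
    continuous_const fun s hs => by rw [show s = b from hs, hyz]⟩, fun _ => rfl⟩

/-- Up to `b`, including times before `t`, the integral from `t` meets only times at most `b`, hence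
only `h₁`; this uses `t ≤ b`. Beyond `b` it is split at `b`. -/
theorem IsIntegralSolution.glue {h₁ h₂ : ℝ → E → E} (hh₁ : IsCaratheodoryField T C L h₁)
    (hh₂ : IsCaratheodoryField T C L h₂) {hT : 0 ≤ T} {t b : Icc (0 : ℝ) T} (htb : t ≤ b)
    {x : E} {y z w : C(Icc (0 : ℝ) T, E)} (hy : IsIntegralSolution hT h₁ t x y)
    (hz : IsIntegralSolution hT h₂ b (y b) z) (hw : ∀ s, w s = if s ≤ b then y s else z s) :
    IsIntegralSolution hT (fun s x => if s ≤ b then h₁ s x else h₂ s x) t x w := by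
  have hlow : ∀ s : Icc (0 : ℝ) T, s ≤ b →
      EqOn (fun q => if q ≤ (b : ℝ) then h₁ q (IccExtend hT w q) else h₂ q (IccExtend hT w q))
        (fun q => h₁ q (IccExtend hT y q)) (uIoc t s) := fun s hs q hq => by
    have hq1 : q ≤ b := hq.2.trans (sup_le (show (t : ℝ) ≤ b from htb) (show (s : ℝ) ≤ b from hs))
    have hq2 := uIoc_subset_Icc_of_mem t s hq
    simp only [hq1, if_true]
    rw [IccExtend_of_mem _ _ hq2, IccExtend_of_mem _ _ hq2, hw,
      if_pos (show (⟨q, hq2⟩ : Icc (0 : ℝ) T) ≤ b from hq1)]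
  have hhigh : ∀ s : Icc (0 : ℝ) T, b ≤ s →
      EqOn (fun q => if q ≤ (b : ℝ) then h₁ q (IccExtend hT w q) else h₂ q (IccExtend hT w q))
        (fun q => h₂ q (IccExtend hT z q)) (uIoc b s) := fun s hs q hq => by
    have hq2 := uIoc_subset_Icc_of_mem b s hq
    rw [uIoc_of_le (show (b : ℝ) ≤ s from hs)] at hq
    have hq1 : ¬ q ≤ b := not_le.2 hq.1
    simp only [hq1, if_false]
    rw [IccExtend_of_mem _ _ hq2, IccExtend_of_mem _ _ hq2, hw,
      if_neg (show ¬ (⟨q, hq2⟩ : Icc (0 : ℝ) T) ≤ b from hq1)]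
  intro s
  rw [hw]
  split_ifs with hs
  · rw [hy s, intervalIntegral.integral_congr_ae (.of_forall fun q hq => hlow s hs hq)]
  · have hs' : b ≤ s := (not_le.1 hs).le
    have hi₁ := hh₁.intervalIntegrable (continuous_IccExtend hT y) t b
    have hi₂ := hh₂.intervalIntegrable (continuous_IccExtend hT z) b s
    rw [← intervalIntegral.integral_add_adjacent_intervals (b := (b : ℝ))
      (hi₁.congr (hlow b le_rfl).symm) (hi₂.congr (hhigh s hs').symm),
      intervalIntegral.integral_congr_ae (.of_forall fun q hq => hlow b le_rfl hq),
      intervalIntegral.integral_congr_ae (.of_forall fun q hq => hhigh s hs' hq), ← add_assoc, ← hy b, ← hz s]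

end ODE

/-! ### Closures of solution sets of families of equations -/

/-- A nonempty family of right-hand sides with common constants, stable under switching. -/
structure IsFieldFamily {E : Type*} [NormedAddCommGroup E] (T C : ℝ) (L : ℝ → ℝ)
    (H : Set (ℝ → E → E)) : Prop where
  nonempty : H.Nonempty
  isCaratheodoryField : ∀ h ∈ H, IsCaratheodoryField T C L h
  switch : ∀ h₁ ∈ H, ∀ h₂ ∈ H, ∀ b : ℝ, (fun s x => if s ≤ b then h₁ s x else h₂ s x) ∈ H

/-- The closure of the set of solutions of all equations of the family `H` from `(t, x)`. -/
def solutionSet {E : Type*} [NormedAddCommGroup E] [NormedSpace ℝ E] {T : ℝ} (hT : 0 ≤ T)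
    (H : Set (ℝ → E → E)) (t : Icc (0 : ℝ) T) (x : E) : Set C(Icc (0 : ℝ) T, E) :=
  closure {y | ∃ h ∈ H, IsIntegralSolution hT h t x y}

section SolutionSet

variable {E : Type*} [NormedAddCommGroup E] [NormedSpace ℝ E] {T C : ℝ} {L : ℝ → ℝ}
  {H : Set (ℝ → E → E)} {hT : 0 ≤ T}

theorem IsFieldFamily.solutionSet_nonempty [CompleteSpace E] (hH : IsFieldFamily T C L H)
    (hC : 0 < C) (hL : ∀ R, 0 < L R) (t : Icc (0 : ℝ) T) (x : E) :
    (solutionSet hT H t x).Nonempty := by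
  obtain ⟨h, hh⟩ := hH.nonempty
  obtain ⟨y, hy⟩ := (hH.isCaratheodoryField h hh).exists_isIntegralSolution hC hL hT t x
  exact ⟨y, subset_closure ⟨h, hh, hy⟩⟩

theorem apply_self_of_mem_solutionSet {t : Icc (0 : ℝ) T} {x : E} {y : C(Icc (0 : ℝ) T, E)}
    (hy : y ∈ solutionSet hT H t x) : y t = x := by
  have hcl : IsClosed {y : C(Icc (0 : ℝ) T, E) | y t = x} :=
    isClosed_eq (by fun_prop) continuous_const
  have hsub : {y | ∃ h ∈ H, IsIntegralSolution hT h t x y} ⊆ {y | y t = x} := by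
    rintro y ⟨h, -, hy⟩
    exact hy.apply_self
  exact closure_minimal hsub hcl hy

theorem solutionSet_mono {H' : Set (ℝ → E → E)} (hHH' : H ⊆ H') (t : Icc (0 : ℝ) T) (x : E) :
    solutionSet hT H t x ⊆ solutionSet hT H' t x :=
  closure_mono fun _ ⟨h, hh, hy⟩ => ⟨h, hHH' hh, hy⟩

/-! ### Compactness, closed graph and concatenation -/

omit [NormedSpace ℝ E] in
theorem isCompact_setOf_bounded_lipschitz [ProperSpace E] (A B : ℝ) :
    IsCompact {y : C(Icc (0 : ℝ) T, E) | (∀ s, ‖y s‖ ≤ A) ∧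
      ∀ a b : Icc (0 : ℝ) T, ‖y b - y a‖ ≤ B * |(b : ℝ) - a|} := by
  set K := {y : C(Icc (0 : ℝ) T, E) | (∀ s, ‖y s‖ ≤ A) ∧
      ∀ a b : Icc (0 : ℝ) T, ‖y b - y a‖ ≤ B * |(b : ℝ) - a|} with hK
  have hBn : ∀ y ∈ K, LipschitzWith B.toNNReal y := fun y hy =>
    LipschitzWith.of_dist_le_mul fun a b => by
      rw [dist_comm, dist_eq_norm, dist_comm, Subtype.dist_eq, Real.dist_eq]
      exact (hy.2 a b).trans (by gcongr; exact Real.le_coe_toNNReal B)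
  refine ArzelaAscoli.isCompact_of_equicontinuous K ?_ ?_
  -- The Lipschitz bound already forces continuity, so the image is cut out of all functions by
  -- pointwise closed conditions and is closed in a product of compact balls.
  · have himg : ContinuousMap.toFun '' K =
        {y : Icc (0 : ℝ) T → E | (∀ s, ‖y s‖ ≤ A) ∧
          ∀ a b : Icc (0 : ℝ) T, ‖y b - y a‖ ≤ B * |(b : ℝ) - a|} := by
      ext y
      constructor
      · rintro ⟨y, hy, rfl⟩; exact hy
      · intro hy
        have hlip : LipschitzWith B.toNNReal y := LipschitzWith.of_dist_le_mul fun a b => by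
          rw [dist_comm, dist_eq_norm, dist_comm, Subtype.dist_eq, Real.dist_eq]
          exact (hy.2 a b).trans (by gcongr; exact Real.le_coe_toNNReal B)
        exact ⟨⟨y, hlip.continuous⟩, hy, rfl⟩
    rw [himg]
    refine (isCompact_univ_pi fun _ : Icc (0 : ℝ) T => isCompact_closedBall (0 : E) A).of_isClosed_subset
      ?_ fun y hy s _ => by simpa using hy.1 s
    simp only [ofPred_and, ofPred_forall]
    refine (isClosed_iInter fun s => isClosed_le (by fun_prop) (by fun_prop)).inter
      (isClosed_iInter fun a => isClosed_iInter fun b => isClosed_le (by fun_prop) (by fun_prop))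
  · exact (LipschitzWith.uniformEquicontinuous (fun y : K => (y : Icc (0 : ℝ) T → E)) B.toNNReal
      fun y => hBn y y.2).equicontinuous

/-- Growth alone bounds the solutions and their speed. The compact set is chosen before the family,
so it serves all kinds of motion at once. -/
theorem exists_isCompact_solutionSet_subset (E : Type*) [NormedAddCommGroup E] [NormedSpace ℝ E]
    [ProperSpace E] (hT : 0 ≤ T) (hC : 0 < C) (L : ℝ → ℝ) (R : ℝ) :
    ∃ K : Set C(Icc (0 : ℝ) T, E), IsCompact K ∧ ∀ H : Set (ℝ → E → E), IsFieldFamily T C L H →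
      ∀ (t : Icc (0 : ℝ) T) (x : E), ‖x‖ ≤ R → solutionSet hT H t x ⊆ K := by
  refine ⟨_, isCompact_setOf_bounded_lipschitz ((2 * R + 1) * Real.exp (2 * C * T))
    (C * (1 + (2 * R + 1) * Real.exp (2 * C * T))), fun H hH t x hx => ?_⟩
  refine closure_minimal ?_ (isCompact_setOf_bounded_lipschitz _ _).isClosed
  rintro y ⟨h, hh, hy⟩
  have hh' := hH.isCaratheodoryField h hh
  refine ⟨fun s => (hy.norm_le hC hh' s).trans (by gcongr), fun a b =>
    (hy.norm_sub_le hC hh' a b).trans (by gcongr)⟩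

/-- A motion from a nearby initial position is replaced by the solution of the same field from `(t,
x)`; the stability constant is uniform over the family. -/
theorem IsFieldFamily.isClosed_graph [CompleteSpace E] (hH : IsFieldFamily T C L H)
    (hC : 0 < C) (hL : ∀ R, 0 < L R) :
    IsClosed {p : (Icc (0 : ℝ) T × E) × C(Icc (0 : ℝ) T, E) |
      p.2 ∈ solutionSet hT H p.1.1 p.1.2} := by
  refine isClosed_of_closure_subset fun p hp => ?_
  obtain ⟨⟨t, x⟩, y⟩ := p
  obtain ⟨K, hK0, hK⟩ := exists_forall_norm_sub_le E hT hC hL (‖x‖ + 1)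
  refine Metric.mem_closure_iff.2 fun ε hε => ?_
  -- The total error will be at most `2 * δ + 2 * K * δ ≤ ε / 2`; the bound `δ ≤ 1` keeps `x'` in
  -- the ball for which `K` was chosen.
  set δ := min 1 (ε / (4 * (K + 1))) with hδ
  have hδ0 : 0 < δ := by positivity
  have hδ1 : δ ≤ 1 := min_le_left _ _
  have hδ2 : 4 * (K + 1) * δ ≤ ε := by
    have : δ ≤ ε / (4 * (K + 1)) := min_le_right _ _
    rwa [le_div_iff₀ (by positivity), mul_comm] at this
  obtain ⟨⟨⟨t', x'⟩, y'⟩, hy', hd⟩ := Metric.mem_closure_iff.1 hp δ hδ0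
  simp only [Prod.dist_eq, max_lt_iff] at hd
  obtain ⟨⟨hdt, hdx⟩, hdy⟩ := hd
  obtain ⟨y'', ⟨h, hh, hy''⟩, hd''⟩ := Metric.mem_closure_iff.1 hy' δ hδ0
  have hh' := hH.isCaratheodoryField h hh
  obtain ⟨z, hz⟩ := hh'.exists_isIntegralSolution hC hL hT t x
  refine ⟨z, ⟨h, hh, hz⟩, ?_⟩
  have hx' : ‖x'‖ ≤ ‖x‖ + 1 := by
    have h1 : ‖x'‖ - ‖x‖ ≤ ‖x' - x‖ := norm_sub_norm_le _ _
    rw [← dist_eq_norm, dist_comm] at h1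
    linarith
  have h1 : dist z y'' ≤ K * (dist t t' + dist x x') :=
    (ContinuousMap.dist_le (by positivity)).2 fun s => by
      rw [dist_eq_norm]
      exact hK h hh' t t' x x' (by linarith) hx' z y'' hz hy'' s
  have h2 : dist y z ≤ dist y y' + dist y' y'' + dist z y'' := by
    rw [dist_comm z]; exact dist_triangle4 _ _ _ _
  have h3 : K * (dist t t' + dist x x') ≤ K * (δ + δ) := by gcongr
  nlinarith

/-- Motions can be continued: the family of solution sets has the concatenation property. -/
theorem IsFieldFamily.exists_concat [CompleteSpace E] (hH : IsFieldFamily T C L H)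
    (hC : 0 < C) (hL : ∀ R, 0 < L R) {t b : Icc (0 : ℝ) T} (htb : t ≤ b) {x : E}
    {y z : C(Icc (0 : ℝ) T, E)} (hy : y ∈ solutionSet hT H t x)
    (hz : z ∈ solutionSet hT H b (y b)) :
    ∃ w ∈ solutionSet hT H t x, ∀ s, b ≤ s → w s = z s := by
  have hzb : z b = y b := apply_self_of_mem_solutionSet hz
  obtain ⟨w, hw⟩ := exists_glue b y z hzb.symm
  refine ⟨w, ?_, fun s hs => ?_⟩
  swap
  · rw [hw]
    split_ifs with hsb
    · rw [le_antisymm hsb hs, hzb]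
    · rfl
  obtain ⟨K, hK0, hK⟩ := exists_forall_norm_sub_le E hT hC hL (‖y b‖ + 1)
  refine Metric.mem_closure_iff.2 fun ε hε => ?_
  set δ := min 1 (ε / (4 * (K + 1))) with hδ
  have hδ0 : 0 < δ := by positivity
  have hδ1 : δ ≤ 1 := min_le_left _ _
  have hδ2 : 4 * (K + 1) * δ ≤ ε := by
    have : δ ≤ ε / (4 * (K + 1)) := min_le_right _ _
    rwa [le_div_iff₀ (by positivity), mul_comm] at this
  obtain ⟨y', ⟨h₁, hh₁, hy'⟩, hdy⟩ := Metric.mem_closure_iff.1 hy δ hδ0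
  obtain ⟨z', ⟨h₂, hh₂, hz'⟩, hdz⟩ := Metric.mem_closure_iff.1 hz δ hδ0
  have hf₁ := hH.isCaratheodoryField h₁ hh₁
  have hf₂ := hH.isCaratheodoryField h₂ hh₂
  -- The approximation `z'` starts at `y b`, not at `y' b`; restarting its field at `y' b` makes
  -- gluing possible at a cost of `K * δ`.
  obtain ⟨z'', hz''⟩ := hf₂.exists_isIntegralSolution hC hL hT b (y' b)
  obtain ⟨w', hw'⟩ := exists_glue b y' z'' hz''.apply_self.symm
  refine ⟨w', ⟨_, hH.switch h₁ hh₁ h₂ hh₂ b, hy'.glue hf₁ hf₂ htb hz'' hw'⟩, ?_⟩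
  have hyb : dist (y b) (y' b) ≤ δ := (y.dist_apply_le_dist b).trans hdy.le
  have hyb' : ‖y' b‖ ≤ ‖y b‖ + 1 := by
    have h1 : ‖y' b‖ - ‖y b‖ ≤ ‖y' b - y b‖ := norm_sub_norm_le _ _
    rw [← dist_eq_norm, dist_comm] at h1
    linarith
  have hle : dist w w' ≤ δ + K * δ := by
    refine (ContinuousMap.dist_le (by positivity)).2 fun s => ?_
    rw [hw, hw']
    split_ifs with hs
    · exact ((y.dist_apply_le_dist s).trans hdy.le).trans (le_add_of_nonneg_right (by positivity))
    · have h1 := hK h₂ hf₂ b b (y b) (y' b) (by linarith) hyb' z' z'' hz' hz'' s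
      rw [← dist_eq_norm, dist_self, zero_add] at h1
      calc dist (z s) (z'' s) ≤ dist (z s) (z' s) + dist (z' s) (z'' s) := dist_triangle _ _ _
        _ ≤ δ + K * δ := by
          gcongr
          · exact (z.dist_apply_le_dist s).trans hdz.le
          · exact h1.trans (by gcongr)
  refine hle.trans_lt ?_
  nlinarith

end SolutionSet

/-! ### Viable multifunctions: discrete times and passage to the limit -/

/-- A family of motion sets `Sol i t x`, each with a relation `r i` between values, where `i₀` is
the index for which the value is preserved; `σ` is the payoff at the terminal time `τ`. -/
structure IsViabilitySystem {ι I E V : Type*} [LinearOrder I] [TopologicalSpace I] [CompactSpace I]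
    [NormedAddCommGroup E] [TopologicalSpace V] (Sol : ι → I → E → Set C(I, E))
    (r : ι → V → V → Prop) (i₀ : ι) (τ : I) (σ : E → V) : Prop where
  le_terminal : ∀ t, t ≤ τ
  continuous_payoff : Continuous σ
  nonempty : ∀ i t x, (Sol i t x).Nonempty
  apply_self : ∀ i t x, ∀ y ∈ Sol i t x, y t = x
  isClosed_graph : ∀ i, IsClosed {p : (I × E) × C(I, E) | p.2 ∈ Sol i p.1.1 p.1.2}
  concat : ∀ i t b x, t ≤ b → ∀ y ∈ Sol i t x, ∀ z ∈ Sol i b (y b),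
    ∃ w ∈ Sol i t x, ∀ s, b ≤ s → w s = z s
  exists_isCompact : ∀ R : ℝ, ∃ K : Set C(I, E), IsCompact K ∧ ∀ i t x, ‖x‖ ≤ R → Sol i t x ⊆ K
  isClosed_rel : ∀ i, IsClosed {p : V × V | r i p.1 p.2}
  rel_refl : ∀ i J, r i J J
  rel_trans : ∀ i J₁ J₂ J₃, r i J₁ J₂ → r i J₂ J₃ → r i J₁ J₃
  eq_of_rel : ∀ J J', r i₀ J J' → J = J'
  -- The only game-theoretic input: one value must serve all indices simultaneously.
  step_nonempty : ∀ G : E → Set V, (∀ x, (G x).Nonempty) → IsClosed {p : E × V | p.2 ∈ G p.1} →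
    (∀ R : ℝ, ∃ K : Set V, IsCompact K ∧ ∀ x, ‖x‖ ≤ R → G x ⊆ K) → ∀ a b x, a ≤ b →
    {J | ∀ i, ∃ y ∈ Sol i a x, ∃ J' ∈ G (y b), r i J' J}.Nonempty

/-- From every value at time `t` one can pass along a motion of each kind to a related value at
time `t'`. -/
def IsViable {ι I E V : Type*} [TopologicalSpace I] [NormedAddCommGroup E]
    (Sol : ι → I → E → Set C(I, E)) (r : ι → V → V → Prop) (S : I → E → Set V) (t t' : I) : Prop :=
  ∀ i x, ∀ J ∈ S t x, ∃ y ∈ Sol i t x, ∃ J' ∈ S t' (y t'), r i J' J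

/-- A multifunction with the viability property for the times of the finite set `F`. -/
structure IsDiscreteSolution {ι I E V : Type*} [LinearOrder I] [TopologicalSpace I]
    [NormedAddCommGroup E] [TopologicalSpace V] (Sol : ι → I → E → Set C(I, E))
    (r : ι → V → V → Prop) (τ : I) (σ : E → V) (F : Finset I) (S : I → E → Set V) : Prop where
  nonempty : ∀ t ∈ F, ∀ x, (S t x).Nonempty
  isClosed_graph : ∀ t ∈ F, IsClosed {p : E × V | p.2 ∈ S t p.1}
  terminal : ∀ x, S τ x = {σ x}
  isViable : ∀ t ∈ F, ∀ t' ∈ F, t ≤ t' → IsViable Sol r S t t'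

/-- Produces points of the upper limit of the sets `{b | P a b}` as `a` runs along `l`. -/
theorem mapClusterPt_of_tendsto {α A B : Type*} [TopologicalSpace B] (U : Ultrafilter α)
    {l : Filter A} {P : A → B → Prop} {f : α → A} {g : α → B} {b : B} (hf : Tendsto f U l)
    (hg : Tendsto g U (𝓝 b)) (hP : ∀ᶠ q in U, P (f q) (g q)) :
    MapClusterPt b (comap Prod.fst l ⊓ 𝓟 {q : A × B | P q.1 q.2}) Prod.snd := by
  refine mapClusterPt_iff_ultrafilter.2 ⟨U.map fun q => (f q, g q), ?_, hg⟩
  exact le_inf (map_le_iff_le_comap.1 hf) (le_principal_iff.2 hP)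

namespace IsViabilitySystem

variable {ι I E V : Type*} [LinearOrder I] [TopologicalSpace I] [CompactSpace I]
  [NormedAddCommGroup E] [TopologicalSpace V] {Sol : ι → I → E → Set C(I, E)}
  {r : ι → V → V → Prop} {i₀ : ι} {τ : I} {σ : E → V}

/-- Compactness of motions and values along an ultrafilter. -/
theorem exists_tendsto (h : IsViabilitySystem Sol r i₀ τ σ) {α : Type*} (U : Ultrafilter α)
    {i : ι} {t : α → I} {x : α → E} {J : α → V} {t₀ : I} {x₀ : E} {J₀ : V}
    (ht : Tendsto t U (𝓝 t₀)) (hx : Tendsto x U (𝓝 x₀)) (hJ : Tendsto J U (𝓝 J₀)) (t' : I)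
    (G : α → E → Set V)
    (hG : ∀ R : ℝ, ∃ K : Set V, IsCompact K ∧ ∀ᶠ q in U, ∀ x, ‖x‖ ≤ R → G q x ⊆ K)
    (hex : ∀ᶠ q in U, ∃ y ∈ Sol i (t q) (x q), ∃ J' ∈ G q (y t'), r i J' (J q)) :
    ∃ y ∈ Sol i t₀ x₀, ∃ J', r i J' J₀ ∧ ∃ (z : α → E) (J'' : α → V),
      (∀ᶠ q in U, J'' q ∈ G q (z q)) ∧ Tendsto z U (𝓝 (y t')) ∧ Tendsto J'' U (𝓝 J') := by
  classical
  obtain ⟨q₀, y₀, -, J₀', -⟩ := hex.exists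
  have hch : ∀ q, ∃ p : C(I, E) × V, (∃ y ∈ Sol i (t q) (x q), ∃ J' ∈ G q (y t'), r i J' (J q)) →
      p.1 ∈ Sol i (t q) (x q) ∧ p.2 ∈ G q (p.1 t') ∧ r i p.2 (J q) := fun q => by
    by_cases hq : ∃ y ∈ Sol i (t q) (x q), ∃ J' ∈ G q (y t'), r i J' (J q)
    · obtain ⟨y, hy, J', hJ', hr⟩ := hq
      exact ⟨(y, J'), fun _ => ⟨hy, hJ', hr⟩⟩
    · exact ⟨(y₀, J₀'), fun h => (hq h).elim⟩
  choose p hp using hch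
  have hp' := hex.mono fun q => hp q
  obtain ⟨K, hK, hKS⟩ := h.exists_isCompact (‖x₀‖ + 1)
  have hxb : ∀ᶠ q in U, ‖x q‖ ≤ ‖x₀‖ + 1 :=
    (hx.norm.eventually_lt_const (lt_add_one _)).mono fun _ => le_of_lt
  have hyK : ∀ᶠ q in U, (p q).1 ∈ K := by
    filter_upwards [hp', hxb] with q hq hxq using hKS i _ _ hxq hq.1
  obtain ⟨y, hyK', hy⟩ := hK.ultrafilter_le_nhds' (U.map fun q => (p q).1) hyK
  have hy' : Tendsto (fun q => (p q).1) U (𝓝 y) := hy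
  have hz : Tendsto (fun q => (p q).1 t') U (𝓝 (y t')) :=
    ((ContinuousEvalConst.continuous_eval_const t').tendsto y).comp hy'
  have hzb : ∀ᶠ q in U, ‖(p q).1 t'‖ ≤ ‖y t'‖ + 1 :=
    (hz.norm.eventually_lt_const (lt_add_one _)).mono fun _ => le_of_lt
  -- The endpoints converge, hence are eventually bounded, and one compact set contains the values
  -- of almost all `G q` there.
  obtain ⟨K', hK', hKG⟩ := hG (‖y t'‖ + 1)
  have hJK : ∀ᶠ q in U, (p q).2 ∈ K' := by
    filter_upwards [hp', hzb, hKG] with q hq hzq hKq using hKq _ hzq hq.2.1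
  obtain ⟨J', -, hJ'⟩ := hK'.ultrafilter_le_nhds' (U.map fun q => (p q).2) hJK
  have hJ'' : Tendsto (fun q => (p q).2) U (𝓝 J') := hJ'
  refine ⟨y, ?_, J', ?_, fun q => (p q).1 t', fun q => (p q).2, hp'.mono fun q hq => hq.2.1, hz,
    hJ''⟩
  · exact (h.isClosed_graph i).mem_of_tendsto ((ht.prodMk_nhds hx).prodMk_nhds hy')
      (hp'.mono fun q hq => hq.1)
  · exact (h.isClosed_rel i).mem_of_tendsto (hJ''.prodMk_nhds hJ) (hp'.mono fun q hq => hq.2.2)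

theorem exists_isCompact_values (h : IsViabilitySystem Sol r i₀ τ σ) (R : ℝ) :
    ∃ K : Set V, IsCompact K ∧ ∀ t x, ‖x‖ ≤ R → ∀ y ∈ Sol i₀ t x, σ (y τ) ∈ K := by
  obtain ⟨K, hK, hKS⟩ := h.exists_isCompact R
  have hc : Continuous fun y : C(I, E) => σ (y τ) :=
    h.continuous_payoff.comp (ContinuousEvalConst.continuous_eval_const τ)
  exact ⟨_, hK.image hc, fun t x hx y hy => mem_image_of_mem _ (hKS i₀ t x hx hy)⟩

theorem exists_payoff (h : IsViabilitySystem Sol r i₀ τ σ) {S : I → E → Set V} {t : I}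
    (hS : ∀ x, S τ x = {σ x}) (hv : IsViable Sol r S t τ) {x : E} {J : V} (hJ : J ∈ S t x) :
    ∃ y ∈ Sol i₀ t x, J = σ (y τ) := by
  obtain ⟨y, hy, J', hJ', hr⟩ := hv i₀ x J hJ
  rw [hS, mem_singleton_iff] at hJ'
  exact ⟨y, hy, by rw [← hJ', h.eq_of_rel _ _ hr]⟩

/-- Every value is the payoff of an `i₀`-motion. That `K` precedes `S` is essential: it bounds all
discrete solutions together. -/
theorem exists_isCompact_of_isViable (h : IsViabilitySystem Sol r i₀ τ σ) (R : ℝ) :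
    ∃ K : Set V, IsCompact K ∧ ∀ (S : I → E → Set V) (t : I), (∀ x, S τ x = {σ x}) →
      IsViable Sol r S t τ → ∀ x, ‖x‖ ≤ R → S t x ⊆ K := by
  obtain ⟨K, hK, hKS⟩ := h.exists_isCompact_values R
  refine ⟨K, hK, fun S t hS hv x hx J hJ => ?_⟩
  obtain ⟨y, hy, rfl⟩ := h.exists_payoff hS hv hJ
  exact hKS t x hx y hy

/-! ### Backward induction over finite sets of times -/

theorem isViable_refl (h : IsViabilitySystem Sol r i₀ τ σ) (S : I → E → Set V) (t : I) :
    IsViable Sol r S t t := fun i x J hJ => by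
  obtain ⟨y, hy⟩ := h.nonempty i t x
  exact ⟨y, hy, J, by rwa [h.apply_self i t x y hy], h.rel_refl i J⟩

theorem isViable_trans (h : IsViabilitySystem Sol r i₀ τ σ) {S : I → E → Set V} {a b c : I}
    (hab : a ≤ b) (hbc : b ≤ c) (h₁ : IsViable Sol r S a b) (h₂ : IsViable Sol r S b c) :
    IsViable Sol r S a c := fun i x J hJ => by
  obtain ⟨y, hy, J', hJ', hr⟩ := h₁ i x J hJ
  obtain ⟨z, hz, J'', hJ'', hr'⟩ := h₂ i (y b) J' hJ'
  obtain ⟨w, hw, hwz⟩ := h.concat i a b x hab y hy z hz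
  exact ⟨w, hw, J'', by rwa [hwz c hbc], h.rel_trans i _ _ _ hr' hr⟩

/-- Only the step from `a` to the next time `b` has to be solved; the later times follow by
concatenating motions and composing relations. -/
theorem exists_discreteSolution_insert (h : IsViabilitySystem Sol r i₀ τ σ) {F : Finset I}
    (hτ : τ ∈ F) {a : I} (ha : ∀ t ∈ F, a < t) {S : I → E → Set V}
    (hS : IsDiscreteSolution Sol r τ σ F S) :
    ∃ S', IsDiscreteSolution Sol r τ σ (insert a F) S' := by
  classical
  set b := F.min' ⟨τ, hτ⟩ with hb
  have hbF : b ∈ F := F.min'_mem _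
  have hab : a < b := ha b hbF
  have hbd : ∀ R : ℝ, ∃ K : Set V, IsCompact K ∧ ∀ x, ‖x‖ ≤ R → S b x ⊆ K := fun R => by
    obtain ⟨K, hK, hKS⟩ := h.exists_isCompact_of_isViable R
    exact ⟨K, hK, hKS S b hS.terminal (hS.isViable b hbF τ hτ (h.le_terminal b))⟩
  -- At `a` all values viable up to `b` are taken: the largest choice, for which the graph is
  -- closed.
  set S' : I → E → Set V := Function.update S a
    fun x => {J | ∀ i, ∃ y ∈ Sol i a x, ∃ J' ∈ S b (y b), r i J' J} with hS'
  have hS'a : ∀ x, S' a x = {J | ∀ i, ∃ y ∈ Sol i a x, ∃ J' ∈ S b (y b), r i J' J} := fun x => by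
    rw [hS', Function.update_self]
  have hS't : ∀ t ∈ F, S' t = S t := fun t ht => Function.update_of_ne (ha t ht).ne' _ _
  have hold : ∀ t ∈ F, ∀ t' ∈ F, t ≤ t' → IsViable Sol r S' t t' := fun t ht t' ht' htt' => by
    intro i x J hJ
    rw [hS't t ht] at hJ
    rw [hS't t' ht']
    exact hS.isViable t ht t' ht' htt' i x J hJ
  have hnew : IsViable Sol r S' a b := fun i x J hJ => by
    rw [hS'a] at hJ
    rw [hS't b hbF]
    exact hJ i
  refine ⟨S', ⟨fun t ht x => ?_, fun t ht => ?_, fun x => ?_, fun t ht t' ht' htt' => ?_⟩⟩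
  · rcases Finset.mem_insert.1 ht with rfl | ht
    · rw [hS'a]
      exact h.step_nonempty (S b) (hS.nonempty b hbF) (hS.isClosed_graph b hbF) hbd _ b x hab.le
    · rw [hS't t ht]
      exact hS.nonempty t ht x
  · rcases Finset.mem_insert.1 ht with rfl | ht
    · simp only [hS'a]
      refine isClosed_iff_ultrafilter.2 fun p U hU hmem i => ?_
      have h1 : Tendsto (fun q : E × V => q.1) U (𝓝 p.1) := (continuous_fst.tendsto p).mono_left hU
      have h2 : Tendsto (fun q : E × V => q.2) U (𝓝 p.2) := (continuous_snd.tendsto p).mono_left hU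
      obtain ⟨y, hy, J', hr, z, J'', hJ'', hz, hJlim⟩ := h.exists_tendsto U (i := i)
        (tendsto_const_nhds (x := t)) h1 h2 b (fun _ => S b)
        (fun R => (hbd R).imp fun K hK => ⟨hK.1, .of_forall fun _ => hK.2⟩)
        (by filter_upwards [hmem] with q hq using hq i)
      exact ⟨y, hy, J', (hS.isClosed_graph b hbF).mem_of_tendsto (hz.prodMk_nhds hJlim) hJ'', hr⟩
    · rw [hS't t ht]
      exact hS.isClosed_graph t ht
  · rw [hS't τ hτ, hS.terminal]
  · rcases Finset.mem_insert.1 ht with rfl | ht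
    · rcases Finset.mem_insert.1 ht' with rfl | ht'
      · exact h.isViable_refl S' _
      · exact h.isViable_trans hab.le (F.min'_le _ ht') hnew
          (hold b hbF t' ht' (F.min'_le _ ht'))
    · rcases Finset.mem_insert.1 ht' with h' | ht'
      · exact absurd htt' (not_le.2 (h' ▸ ha t ht))
      · exact hold t ht t' ht' htt'

theorem exists_discreteSolution [DecidableEq I] [T2Space V]
    (h : IsViabilitySystem Sol r i₀ τ σ) (F : Finset I) :
    ∃ S, IsDiscreteSolution Sol r τ σ (insert τ F) S := by
  induction F using Finset.induction_on_min with
  | empty =>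
    refine ⟨fun _ x => {σ x}, fun _ _ _ => singleton_nonempty _, fun _ _ => ?_, fun _ => rfl, ?_⟩
    · exact isClosed_eq continuous_snd (h.continuous_payoff.comp continuous_fst)
    · intro t ht t' ht' _
      simp only [insert_empty_eq, Finset.mem_singleton] at ht ht'
      rw [ht, ht']
      exact h.isViable_refl _ _
  | insert a s ha ih =>
    obtain ⟨S, hS⟩ := ih
    rcases eq_or_ne a τ with rfl | hne
    · exact ⟨S, by simpa using hS⟩
    · rw [Finset.insert_comm]
      convert h.exists_discreteSolution_insert (Finset.mem_insert_self τ s) (a := a) ?_ hS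
      intro t ht
      rcases Finset.mem_insert.1 ht with rfl | ht
      · exact lt_of_le_of_ne (h.le_terminal a) hne
      · exact ha t ht

/-! ### Passage to the limit over finite sets of times -/

/-- Existence of a viable multifunction: cluster points of discrete solutions. -/
theorem exists_viable [OrderTopology I] [T2Space V] (h : IsViabilitySystem Sol r i₀ τ σ) :
    ∃ S : I × E → Set V, (∀ p, (S p).Nonempty) ∧
      IsClosed {q : (I × E) × V | q.2 ∈ S q.1} ∧ (∀ x, S (τ, x) = {σ x}) ∧
      ∀ t t', t ≤ t' → IsViable Sol r (fun s x => S (s, x)) t t' := by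
  classical
  choose D hD using fun F => h.exists_discreteSolution F
  have hτF : ∀ F : Finset I, τ ∈ insert τ F := fun F => Finset.mem_insert_self τ F
  have hbd : ∀ R : ℝ, ∃ K : Set V, IsCompact K ∧ ∀ F : Finset I, ∀ t ∈ insert τ F,
      ∀ x, ‖x‖ ≤ R → D F t x ⊆ K := fun R => by
    obtain ⟨K, hK, hKS⟩ := h.exists_isCompact_of_isViable R
    exact ⟨K, hK, fun F t ht => hKS _ t (hD F).terminal
      ((hD F).isViable t ht τ (hτF F) (h.le_terminal t))⟩
  -- Only times of `insert τ F` are kept, since nothing is known of `D F` at other times.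
  let P : Finset I → (I × E) × V → Prop := fun F q => q.1.1 ∈ insert τ F ∧ q.2 ∈ D F q.1.1 q.1.2
  -- The upper limit of the graphs as `F` grows; time varies along with position and value, which
  -- makes the graph closed in all variables.
  let S : I × E → Set V := fun p => {J | MapClusterPt (p, J)
    (comap Prod.fst atTop ⊓ 𝓟 {q : Finset I × ((I × E) × V) | P q.1 q.2}) Prod.snd}
  have hdata : ∀ t x, ∀ J ∈ S (t, x), ∃ U : Ultrafilter (Finset I × ((I × E) × V)),
      Tendsto (fun q => q.1) (U : Filter (Finset I × ((I × E) × V))) atTop ∧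
      (∀ᶠ q in (U : Filter (Finset I × ((I × E) × V))), P q.1 q.2) ∧
      Tendsto (fun q => q.2.1.1) (U : Filter (Finset I × ((I × E) × V))) (𝓝 t) ∧
      Tendsto (fun q => q.2.1.2) (U : Filter (Finset I × ((I × E) × V))) (𝓝 x) ∧
      Tendsto (fun q => q.2.2) (U : Filter (Finset I × ((I × E) × V))) (𝓝 J) := by
    intro t x J hJ
    obtain ⟨U, hU, hlim⟩ := mapClusterPt_iff_ultrafilter.1 hJ
    have h1 := (continuous_fst.tendsto ((t, x), J)).comp hlim
    exact ⟨U, tendsto_iff_comap.2 (hU.trans inf_le_left), le_principal_iff.1 (hU.trans inf_le_right),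
      (continuous_fst.tendsto (t, x)).comp h1, (continuous_snd.tendsto (t, x)).comp h1,
      (continuous_snd.tendsto ((t, x), J)).comp hlim⟩
  -- Values at times tending to `τ` are payoffs of `i₀`-motions; in the limit the motion starts at
  -- `τ`, so its payoff is `σ x`.
  have hterm : ∀ x, ∀ J ∈ S (τ, x), J = σ x := by
    intro x J hJ
    obtain ⟨U, -, hP, ht, hx, hJlim⟩ := hdata τ x J hJ
    have hG : ∀ R : ℝ, ∃ K : Set V, IsCompact K ∧
        ∀ᶠ q in (U : Filter (Finset I × ((I × E) × V))), ∀ x : E, ‖x‖ ≤ R → {σ x} ⊆ K := fun R => by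
      obtain ⟨K, hK, hKS⟩ := hbd R
      refine ⟨K, hK, .of_forall fun _ x hx => ?_⟩
      rw [← (hD ∅).terminal x]
      exact hKS ∅ τ (hτF ∅) x hx
    obtain ⟨y, hy, J', hr, z, J'', hJ'', hz, hlim⟩ := h.exists_tendsto U (i := i₀) ht hx hJlim τ
      (fun _ x => {σ x}) hG (by
        filter_upwards [hP] with q hq
        obtain ⟨y, hy, J', hJ', hr⟩ :=
          (hD q.1).isViable _ hq.1 τ (hτF _) (h.le_terminal _) i₀ _ _ hq.2
        rw [(hD q.1).terminal] at hJ'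
        exact ⟨y, hy, J', hJ', hr⟩)
    have h1 : Tendsto J'' U (𝓝 (σ (y τ))) :=
      ((h.continuous_payoff.tendsto _).comp hz).congr' (hJ''.mono fun q hq => hq.symm)
    rw [← h.eq_of_rel _ _ hr, tendsto_nhds_unique hlim h1, h.apply_self i₀ τ x y hy]
  have hne : ∀ p, (S p).Nonempty := by
    rintro ⟨t, x⟩
    have hJF : ∀ F : Finset I, ∃ J : V, t ∈ F → J ∈ D F t x := fun F => by
      by_cases htF : t ∈ F
      · obtain ⟨J, hJ⟩ := (hD F).nonempty t (Finset.mem_insert_of_mem htF) x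
        exact ⟨J, fun _ => hJ⟩
      · exact ⟨σ x, fun h => (htF h).elim⟩
    choose J hJ using hJF
    let U : Ultrafilter (Finset I) := Ultrafilter.of atTop
    have hU : (U : Filter (Finset I)) ≤ atTop := Ultrafilter.of_le _
    have hmem : ∀ᶠ F in (U : Filter (Finset I)), t ∈ F :=
      hU ((eventually_ge_atTop {t}).mono fun F hF => Finset.singleton_subset_iff.1 hF)
    obtain ⟨K, hK, hKS⟩ := hbd ‖x‖
    have hJK : ∀ᶠ F in (U : Filter (Finset I)), J F ∈ K := hmem.mono fun F hF =>
      hKS F t (Finset.mem_insert_of_mem hF) x le_rfl (hJ F hF)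
    obtain ⟨J₀, -, hJ₀⟩ := hK.ultrafilter_le_nhds' (U.map J) hJK
    exact ⟨J₀, mapClusterPt_of_tendsto U (f := id) (g := fun F => ((t, x), J F)) hU
      (tendsto_const_nhds.prodMk_nhds hJ₀)
      (hmem.mono fun F hF => ⟨Finset.mem_insert_of_mem hF, hJ F hF⟩)⟩
  refine ⟨S, hne, isClosed_setOfPred_clusterPt, fun x => ?_, fun t t' htt' => ?_⟩
  · obtain ⟨J, hJ⟩ := hne (τ, x)
    refine Subset.antisymm (fun J hJ => hterm x J hJ) (singleton_subset_iff.2 ?_)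
    rwa [hterm x J hJ] at hJ
  -- Strictness is needed: the approximating times tend to `t` and must eventually lie before `t'`.
  · rcases htt'.eq_or_lt with rfl | hlt
    · exact h.isViable_refl _ _
    · intro i x J hJ
      obtain ⟨U, hF, hP, ht, hx, hJlim⟩ := hdata t x J hJ
      have hmem : ∀ᶠ q in (U : Filter (Finset I × ((I × E) × V))), t' ∈ q.1 :=
        hF.eventually ((eventually_ge_atTop {t'}).mono fun F hF => Finset.singleton_subset_iff.1 hF)
      obtain ⟨y, hy, J', hr, z, J'', hJ'', hz, hlim⟩ := h.exists_tendsto U (i := i) ht hx hJlim t'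
        (fun q => D q.1 t') (fun R => by
          obtain ⟨K, hK, hKS⟩ := hbd R
          exact ⟨K, hK, hmem.mono fun q hq => hKS q.1 t' (Finset.mem_insert_of_mem hq)⟩) (by
          filter_upwards [hP, hmem, ht.eventually_lt_const hlt] with q h1 h2 h3
          exact (hD q.1).isViable _ h1.1 t' (Finset.mem_insert_of_mem h2) h3.le i _ _ h1.2)
      refine ⟨y, hy, J', ?_, hr⟩
      refine mapClusterPt_of_tendsto U (f := Prod.fst) (g := fun q => ((t', z q), J'' q)) hF
        ((tendsto_const_nhds.prodMk_nhds hz).prodMk_nhds hlim) ?_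
      filter_upwards [hmem, hJ''] with q h1 h2 using ⟨Finset.mem_insert_of_mem h1, h2⟩

/-- A viable multifunction with closed graph is upper hemicontinuous. -/
theorem upperHemicontinuous (h : IsViabilitySystem Sol r i₀ τ σ) {S : I × E → Set V}
    (hcl : IsClosed {q : (I × E) × V | q.2 ∈ S q.1}) (hS : ∀ x, S (τ, x) = {σ x})
    (hv : ∀ t, IsViable Sol r (fun s x => S (s, x)) t τ) : UpperHemicontinuous S := by
  refine upperHemicontinuous_iff_isClosed_compl_preimage_Iic_compl.2 fun u hu => ?_
  -- It suffices that the points whose value set meets a closed `u` form a closed set; the selected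
  -- values converge along `U` by local boundedness.
  refine isClosed_iff_ultrafilter.2 fun p U hU hmem => ?_
  have hex : ∀ᶠ q in (U : Filter (I × E)), ∃ J ∈ S q, J ∈ u := by
    filter_upwards [hmem] with q hq
    simpa [not_subset] using hq
  have hch : ∀ q, ∃ J : V, (∃ J ∈ S q, J ∈ u) → J ∈ S q ∧ J ∈ u := fun q => by
    by_cases hq : ∃ J ∈ S q, J ∈ u
    · exact ⟨hq.choose, fun _ => hq.choose_spec⟩
    · exact ⟨σ q.2, fun h => (hq h).elim⟩
  choose J hJ using hch
  have hJ' := hex.mono hJ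
  obtain ⟨K, hK, hKS⟩ := h.exists_isCompact_of_isViable (‖p.2‖ + 1)
  have hpb : ∀ᶠ q in (U : Filter (I × E)), ‖q.2‖ ≤ ‖p.2‖ + 1 :=
    ((((continuous_snd.tendsto p).mono_left hU).norm).eventually_lt_const (lt_add_one _)).mono
      fun _ => le_of_lt
  have hJK : ∀ᶠ q in (U : Filter (I × E)), J q ∈ K := by
    filter_upwards [hJ', hpb] with q h1 h2
    exact hKS (fun s x => S (s, x)) q.1 hS (hv q.1) q.2 h2 h1.1
  obtain ⟨J₀, -, hJ₀⟩ := hK.ultrafilter_le_nhds' (U.map J) hJK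
  have hlim : Tendsto J U (𝓝 J₀) := hJ₀
  have h1 : J₀ ∈ S p := hcl.mem_of_tendsto
    ((tendsto_id.mono_left hU).prodMk_nhds hlim) (hJ'.mono fun q hq => hq.1)
  have h2 : J₀ ∈ u := hu.mem_of_tendsto hlim (hJ'.mono fun q hq => hq.2)
  exact fun hp => hp h1 h2

end IsViabilitySystem

/-! ### The one-step game -/

/-- The set is the projection of a closed part of `A × K`, with `K` compact and containing the
values of `G` over the bounded set `e '' A`. -/
theorem isCompact_values {Y E V : Type*} [TopologicalSpace Y] [NormedAddCommGroup E]
    [TopologicalSpace V] {G : E → Set V} (hG : IsClosed {p : E × V | p.2 ∈ G p.1})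
    (hbd : ∀ R : ℝ, ∃ K : Set V, IsCompact K ∧ ∀ x, ‖x‖ ≤ R → G x ⊆ K) {e : Y → E}
    (he : Continuous e) {A : Set Y} (hA : IsCompact A) :
    IsCompact {J | ∃ y ∈ A, J ∈ G (e y)} := by
  obtain ⟨R, hR⟩ := hA.exists_bound_of_continuousOn he.continuousOn
  obtain ⟨K, hK, hKG⟩ := hbd R
  have hcl : IsClosed {p : Y × V | p.2 ∈ G (e p.1)} :=
    hG.preimage ((he.comp continuous_fst).prodMk continuous_snd)
  convert ((hA.prod hK).inter_right hcl).image continuous_snd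
  ext J
  constructor
  · rintro ⟨y, hy, hJ⟩
    exact ⟨(y, J), ⟨⟨hy, hKG _ (hR y hy) hJ⟩, hJ⟩, rfl⟩
  · rintro ⟨⟨y, J⟩, ⟨⟨hy, -⟩, hJ⟩, rfl⟩
    exact ⟨y, hy, hJ⟩

/-- A value of the one-step game: each player can secure their maximin. -/
theorem exists_maximin_value {Y E P Q : Type*} [TopologicalSpace Y] [NormedAddCommGroup E]
    [Nonempty P] [Nonempty Q] {G : E → Set (ℝ × ℝ)} (hne : ∀ x, (G x).Nonempty)
    (hG : IsClosed {p : E × (ℝ × ℝ) | p.2 ∈ G p.1})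
    (hbd : ∀ R : ℝ, ∃ K : Set (ℝ × ℝ), IsCompact K ∧ ∀ x, ‖x‖ ≤ R → G x ⊆ K) {e : Y → E}
    (he : Continuous e) {A : Set Y} {A₂ : P → Set Y} {A₁ : Q → Set Y} (hA : IsCompact A)
    (hA₂ : ∀ u, IsCompact (A₂ u)) (hA₁ : ∀ v, IsCompact (A₁ v))
    (hinter : ∀ u v, ∃ y ∈ A, y ∈ A₂ u ∧ y ∈ A₁ v) :
    ∃ J, (∃ y ∈ A, J ∈ G (e y)) ∧ (∀ u, ∃ y ∈ A₂ u, ∃ J' ∈ G (e y), J'.1 ≤ J.1) ∧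
      ∀ v, ∃ y ∈ A₁ v, ∃ J' ∈ G (e y), J'.2 ≤ J.2 := by
  -- A value with least first coordinate over `A₂ u`: what the first player guarantees by the
  -- constant control `u`.
  have h₂ : ∀ u, ∃ J' ∈ {J | ∃ y ∈ A₂ u, J ∈ G (e y)},
      IsMinOn (fun J : ℝ × ℝ => J.1) {J | ∃ y ∈ A₂ u, J ∈ G (e y)} J' := fun u => by
    obtain ⟨y, -, hy, -⟩ := hinter u (Classical.arbitrary Q)
    obtain ⟨J, hJ⟩ := hne (e y)
    exact (isCompact_values hG hbd he (hA₂ u)).exists_isMinOn ⟨J, y, hy, hJ⟩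
      continuous_fst.continuousOn
  have h₁ : ∀ v, ∃ J' ∈ {J | ∃ y ∈ A₁ v, J ∈ G (e y)},
      IsMinOn (fun J : ℝ × ℝ => J.2) {J | ∃ y ∈ A₁ v, J ∈ G (e y)} J' := fun v => by
    obtain ⟨y, -, -, hy⟩ := hinter (Classical.arbitrary P) v
    obtain ⟨J, hJ⟩ := hne (e y)
    exact (isCompact_values hG hbd he (hA₁ v)).exists_isMinOn ⟨J, y, hy, hJ⟩
      continuous_snd.continuousOn
  choose M₂ hM₂ hmin₂ using h₂
  choose M₁ hM₁ hmin₁ using h₁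
  -- Two constraints reduce to the stronger one in each coordinate, so the family is directed. Each
  -- set is nonempty: the motion common to `A`, `A₂ u` and `A₁ v` has values above both minima.
  -- Compactness then replaces attainment of the suprema over `u` and `v`.
  let D : P × Q → Set (ℝ × ℝ) := fun p =>
    {J | ∃ y ∈ A, J ∈ G (e y)} ∩ {J | (M₂ p.1).1 ≤ J.1 ∧ (M₁ p.2).2 ≤ J.2}
  have hD : ∀ p, IsCompact (D p) := fun p =>
    (isCompact_values hG hbd he hA).inter_right ((isClosed_le continuous_const continuous_fst).inter
      (isClosed_le continuous_const continuous_snd))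
  have hdir : Directed (· ⊇ ·) D := fun p q => by
    obtain ⟨u, hu⟩ : ∃ u, (M₂ p.1).1 ≤ (M₂ u).1 ∧ (M₂ q.1).1 ≤ (M₂ u).1 :=
      (le_total (M₂ p.1).1 (M₂ q.1).1).elim (fun h => ⟨_, h, le_rfl⟩) fun h => ⟨_, le_rfl, h⟩
    obtain ⟨v, hv⟩ : ∃ v, (M₁ p.2).2 ≤ (M₁ v).2 ∧ (M₁ q.2).2 ≤ (M₁ v).2 :=
      (le_total (M₁ p.2).2 (M₁ q.2).2).elim (fun h => ⟨_, h, le_rfl⟩) fun h => ⟨_, le_rfl, h⟩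
    exact ⟨(u, v), fun J hJ => ⟨hJ.1, hu.1.trans hJ.2.1, hv.1.trans hJ.2.2⟩,
      fun J hJ => ⟨hJ.1, hu.2.trans hJ.2.1, hv.2.trans hJ.2.2⟩⟩
  have hDne : ∀ p, (D p).Nonempty := fun p => by
    obtain ⟨y, hy, hy₂, hy₁⟩ := hinter p.1 p.2
    obtain ⟨J, hJ⟩ := hne (e y)
    exact ⟨J, ⟨y, hy, hJ⟩, hmin₂ p.1 ⟨y, hy₂, hJ⟩, hmin₁ p.2 ⟨y, hy₁, hJ⟩⟩
  obtain ⟨J, hJ⟩ := IsCompact.nonempty_iInter_of_directed_nonempty_isCompact_isClosed D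
    hdir hDne hD fun p => (hD p).isClosed
  rw [mem_iInter] at hJ
  refine ⟨J, (hJ (Classical.arbitrary _)).1, fun u => ?_, fun v => ?_⟩
  · obtain ⟨y, hy, hJ'⟩ := hM₂ u
    exact ⟨y, hy, _, hJ', (hJ (u, Classical.arbitrary Q)).2.1⟩
  · obtain ⟨y, hy, hJ'⟩ := hM₁ v
    exact ⟨y, hy, _, hJ', (hJ (Classical.arbitrary P, v)).2.2⟩

/-! ### Controlled dynamics -/

section Control

variable {n : ℕ} {P Q : Type*} {T : ℝ}

/-- The right-hand sides `f(t,x,u(t)) + g(t,x,v(t))` for controls `u ∈ A`, `v ∈ B`. -/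
def controlFields (f : ℝ → EuclideanSpace ℝ (Fin n) → P → EuclideanSpace ℝ (Fin n))
    (g : ℝ → EuclideanSpace ℝ (Fin n) → Q → EuclideanSpace ℝ (Fin n))
    (A : Set (ℝ → P)) (B : Set (ℝ → Q)) :
    Set (ℝ → EuclideanSpace ℝ (Fin n) → EuclideanSpace ℝ (Fin n)) :=
  {h | ∃ u ∈ A, ∃ v ∈ B, h = fun s x => f s x (u s) + g s x (v s)}

/-- A nonempty set of measurable controls, stable under switching. -/
structure IsControlFamily [MeasurableSpace P] (A : Set (ℝ → P)) : Prop where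
  nonempty : A.Nonempty
  measurable : ∀ u ∈ A, Measurable u
  switch : ∀ u₁ ∈ A, ∀ u₂ ∈ A, ∀ b : ℝ, (fun s => if s ≤ b then u₁ s else u₂ s) ∈ A

theorem isControlFamily_measurable [MeasurableSpace P] [Nonempty P] :
    IsControlFamily {u : ℝ → P | Measurable u} where
  nonempty := ⟨fun _ => Classical.arbitrary P, measurable_const⟩
  measurable _ hu := hu
  switch _ h₁ _ h₂ _ := Measurable.ite measurableSet_Iic h₁ h₂

theorem isControlFamily_const [MeasurableSpace P] (u : P) :
    IsControlFamily {(fun _ => u : ℝ → P)} where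
  nonempty := singleton_nonempty _
  measurable := by rintro _ rfl; exact measurable_const
  switch := by
    rintro _ rfl _ rfl b
    simp

theorem IsAdmissibleDynamics.aestronglyMeasurable [MetricSpace P] [CompactSpace P]
    [MeasurableSpace P] [BorelSpace P]
    {f : ℝ → EuclideanSpace ℝ (Fin n) → P → EuclideanSpace ℝ (Fin n)}
    (hf : IsAdmissibleDynamics T f) {u : ℝ → P} (hu : Measurable u)
    {y : ℝ → EuclideanSpace ℝ (Fin n)} (hy : Continuous y) :
    AEStronglyMeasurable (fun s => f s (y s) (u s)) (volume.restrict (Icc 0 T)) := by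
  classical
  have : SecondCountableTopology P := EMetric.secondCountable_of_sigmaCompact P
  -- Continuity is available only over `[0,T]`, so `f` is replaced by zero elsewhere; second
  -- countability of `P` reconciles the Borel and product σ-algebras.
  have h1 := hf.continuousOn.measurable_piecewise
    (g := fun _ => (0 : EuclideanSpace ℝ (Fin n))) continuousOn_const
    (measurableSet_Icc.prod MeasurableSet.univ)
  have h2 : Measurable fun s => (s, y s, u s) :=
    measurable_id.prodMk (hy.measurable.prodMk hu)
  refine (h1.comp h2).aestronglyMeasurable.congr ?_
  refine (ae_restrict_iff' measurableSet_Icc).2 (.of_forall fun s hs => ?_)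
  exact piecewise_eq_of_mem _ _ _ ⟨hs, mem_univ _⟩

theorem exists_isFieldFamily_controlFields [MetricSpace P] [CompactSpace P]
    [MeasurableSpace P] [BorelSpace P] [MetricSpace Q] [CompactSpace Q]
    [MeasurableSpace Q] [BorelSpace Q]
    {f : ℝ → EuclideanSpace ℝ (Fin n) → P → EuclideanSpace ℝ (Fin n)}
    {g : ℝ → EuclideanSpace ℝ (Fin n) → Q → EuclideanSpace ℝ (Fin n)}
    (hf : IsAdmissibleDynamics T f) (hg : IsAdmissibleDynamics T g) :
    ∃ (C : ℝ) (L : ℝ → ℝ), 0 < C ∧ (∀ R, 0 < L R) ∧ ∀ A B, IsControlFamily A →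
      IsControlFamily B → IsFieldFamily T C L (controlFields f g A B) := by
  obtain ⟨Cf, hCf⟩ := hf.growth
  obtain ⟨Cg, hCg⟩ := hg.growth
  choose Lf hLf using hf.lipschitz
  choose Lg hLg using hg.lipschitz
  -- The given constants may be negative; absolute values and the added `1` ensure positivity.
  refine ⟨|Cf| + |Cg| + 1, fun R => |Lf R| + |Lg R| + 1, by positivity, fun R => by positivity,
    fun A B hA hB => ⟨?_, ?_, ?_⟩⟩
  · obtain ⟨u, hu⟩ := hA.nonempty
    obtain ⟨v, hv⟩ := hB.nonempty
    exact ⟨_, u, hu, v, hv, rfl⟩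
  · rintro _ ⟨u, hu, v, hv, rfl⟩
    refine ⟨fun y hy => (hf.aestronglyMeasurable (hA.measurable u hu) hy).add
      (hg.aestronglyMeasurable (hB.measurable v hv) hy), fun R t ht x x' hx hx' => ?_,
      fun t ht x => ?_⟩
    · have h1 := hLf R t ht (u t) x x' hx hx'
      have h2 := hLg R t ht (v t) x x' hx hx'
      rw [add_sub_add_comm]
      refine (norm_add_le _ _).trans ((add_le_add h1 h2).trans ?_)
      rw [← add_mul]
      exact mul_le_mul_of_nonneg_right (by linarith [le_abs_self (Lf R), le_abs_self (Lg R)])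
        (by positivity)
    · have h1 := hCf t ht (u t) x
      have h2 := hCg t ht (v t) x
      refine (norm_add_le _ _).trans ((add_le_add h1 h2).trans ?_)
      rw [← add_mul]
      exact mul_le_mul_of_nonneg_right (by linarith [le_abs_self (Cf), le_abs_self (Cg)])
        (by positivity)
  · rintro _ ⟨u₁, hu₁, v₁, hv₁, rfl⟩ _ ⟨u₂, hu₂, v₂, hv₂, rfl⟩ b
    refine ⟨_, hA.switch u₁ hu₁ u₂ hu₂ b, _, hB.switch v₁ hv₁ v₂ hv₂ b, ?_⟩
    ext s x : 2
    split_ifs <;> rfl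

/-- The integrals see only `[0,T]`, so the choice of extension is immaterial, and integrability
along a continuous curve is automatic for a Carathéodory field. -/
theorem isMotion_iff_isIntegralSolution (hT : 0 ≤ T) {C : ℝ} {L : ℝ → ℝ}
    {f : ℝ → EuclideanSpace ℝ (Fin n) → P → EuclideanSpace ℝ (Fin n)}
    {g : ℝ → EuclideanSpace ℝ (Fin n) → Q → EuclideanSpace ℝ (Fin n)} {u : ℝ → P} {v : ℝ → Q}
    (h : IsCaratheodoryField T C L fun s x => f s x (u s) + g s x (v s)) {t₀ : Icc (0 : ℝ) T}
    {x₀ : EuclideanSpace ℝ (Fin n)} {x : C(Icc (0 : ℝ) T, EuclideanSpace ℝ (Fin n))} :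
    IsMotion T f g t₀ x₀ u v x ↔
      IsIntegralSolution hT (fun s x => f s x (u s) + g s x (v s)) t₀ x₀ x := by
  constructor
  · rintro ⟨y, hyx, -, hy⟩ t
    rw [hy t]
    congr 1
    refine intervalIntegral.integral_congr fun s hs => ?_
    have hs' := uIcc_subset_Icc t₀.2 t.2 hs
    have : y s = IccExtend hT x s := by
      rw [IccExtend_of_mem _ _ hs']; exact hyx ⟨s, hs'⟩
    simp only [this]
  · intro hx
    exact ⟨IccExtend hT x, fun t => IccExtend_val _ _ _,
      h.intervalIntegrable (continuous_IccExtend hT x) ⟨0, le_rfl, hT⟩ ⟨T, hT, le_rfl⟩, hx⟩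

theorem solutionSet_controlFields [MetricSpace P] [CompactSpace P]
    [MeasurableSpace P] [BorelSpace P] [MetricSpace Q] [CompactSpace Q]
    [MeasurableSpace Q] [BorelSpace Q]
    {f : ℝ → EuclideanSpace ℝ (Fin n) → P → EuclideanSpace ℝ (Fin n)}
    {g : ℝ → EuclideanSpace ℝ (Fin n) → Q → EuclideanSpace ℝ (Fin n)}
    (hf : IsAdmissibleDynamics T f) (hg : IsAdmissibleDynamics T g) (hT : 0 ≤ T)
    {A : Set (ℝ → P)} {B : Set (ℝ → Q)} (hA : IsControlFamily A) (hB : IsControlFamily B)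
    (t : Icc (0 : ℝ) T) (x : EuclideanSpace ℝ (Fin n)) :
    solutionSet hT (controlFields f g A B) t x =
      closure {y | ∃ u ∈ A, ∃ v ∈ B, IsMotion T f g t x u v y} := by
  obtain ⟨C, L, -, -, hfam⟩ := exists_isFieldFamily_controlFields hf hg
  have hF := (hfam A B hA hB).isCaratheodoryField
  unfold solutionSet
  congr 1
  ext y
  constructor
  · rintro ⟨_, ⟨u, hu, v, hv, rfl⟩, hy⟩
    exact ⟨u, hu, v, hv,
      (isMotion_iff_isIntegralSolution hT (hF _ ⟨u, hu, v, hv, rfl⟩)).2 hy⟩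
  · rintro ⟨u, hu, v, hv, hy⟩
    exact ⟨_, ⟨u, hu, v, hv, rfl⟩,
      (isMotion_iff_isIntegralSolution hT (hF _ ⟨u, hu, v, hv, rfl⟩)).1 hy⟩

/-! ### The three kinds of motion as one indexed family -/

/-- First controls available for the index: `some (inl u)` fixes the first control `u`. -/
def firstControls [MeasurableSpace P] : Option (P ⊕ Q) → Set (ℝ → P)
  | some (Sum.inl u) => {fun _ => u}
  | _ => {u | Measurable u}

/-- Second controls available for the index: `some (inr v)` fixes the second control `v`. -/
def secondControls [MeasurableSpace Q] : Option (P ⊕ Q) → Set (ℝ → Q)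
  | some (Sum.inr v) => {fun _ => v}
  | _ => {v | Measurable v}

/-- The relation between the value after a motion and the value before it. -/
def valueRel : Option (P ⊕ Q) → ℝ × ℝ → ℝ × ℝ → Prop
  | none => fun J' J => J' = J
  | some (Sum.inl _) => fun J' J => J'.1 ≤ J.1
  | some (Sum.inr _) => fun J' J => J'.2 ≤ J.2

theorem isControlFamily_firstControls [MeasurableSpace P] [Nonempty P] (i : Option (P ⊕ Q)) :
    IsControlFamily (firstControls i) := by
  rcases i with _ | u | v
  exacts [isControlFamily_measurable, isControlFamily_const u, isControlFamily_measurable]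

theorem isControlFamily_secondControls [MeasurableSpace Q] [Nonempty Q] (i : Option (P ⊕ Q)) :
    IsControlFamily (secondControls i) := by
  rcases i with _ | u | v
  exacts [isControlFamily_measurable, isControlFamily_measurable, isControlFamily_const v]

theorem const_mem_firstControls [MeasurableSpace P] (u : P) (v : Q) :
    ∀ i ∈ ({none, some (.inl u), some (.inr v)} : Set (Option (P ⊕ Q))),
      (fun _ => u) ∈ firstControls i := by
  rintro i (rfl | rfl | rfl)
  exacts [measurable_const, rfl, measurable_const]

theorem const_mem_secondControls [MeasurableSpace Q] (u : P) (v : Q) :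
    ∀ i ∈ ({none, some (.inl u), some (.inr v)} : Set (Option (P ⊕ Q))),
      (fun _ => v) ∈ secondControls i := by
  rintro i (rfl | rfl | rfl)
  exacts [measurable_const, measurable_const, rfl]

theorem isViabilitySystem_game [MetricSpace P] [CompactSpace P] [Nonempty P]
    [MeasurableSpace P] [BorelSpace P] [MetricSpace Q] [CompactSpace Q] [Nonempty Q]
    [MeasurableSpace Q] [BorelSpace Q]
    {f : ℝ → EuclideanSpace ℝ (Fin n) → P → EuclideanSpace ℝ (Fin n)}
    {g : ℝ → EuclideanSpace ℝ (Fin n) → Q → EuclideanSpace ℝ (Fin n)}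
    (hf : IsAdmissibleDynamics T f) (hg : IsAdmissibleDynamics T g) (hT : 0 ≤ T)
    {σ₁ σ₂ : EuclideanSpace ℝ (Fin n) → ℝ} (hσ₁ : Continuous σ₁) (hσ₂ : Continuous σ₂) :
    IsViabilitySystem
      (fun i : Option (P ⊕ Q) => solutionSet hT (controlFields f g (firstControls i)
        (secondControls i))) valueRel none (⟨T, hT, le_rfl⟩ : Icc (0 : ℝ) T)
      (fun x => (σ₁ x, σ₂ x)) := by
  obtain ⟨C, L, hC, hL, hfam⟩ := exists_isFieldFamily_controlFields hf hg
  have hH : ∀ i : Option (P ⊕ Q), IsFieldFamily T C L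
      (controlFields f g (firstControls i) (secondControls i)) := fun i =>
    hfam _ _ (isControlFamily_firstControls i) (isControlFamily_secondControls i)
  have hcompact : ∀ (i : Option (P ⊕ Q)) t x, IsCompact (solutionSet hT
      (controlFields f g (firstControls i) (secondControls i)) t x) := fun i t x => by
    obtain ⟨K, hK, hKS⟩ :=
      exists_isCompact_solutionSet_subset (EuclideanSpace ℝ (Fin n)) hT hC L ‖x‖
    exact hK.of_isClosed_subset isClosed_closure (hKS _ (hH i) t x le_rfl)
  refine
    { le_terminal := fun t => t.2.2
      continuous_payoff := hσ₁.prodMk hσ₂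
      nonempty := fun i t x => (hH i).solutionSet_nonempty hC hL t x
      apply_self := fun i t x y hy => apply_self_of_mem_solutionSet hy
      isClosed_graph := fun i => (hH i).isClosed_graph hC hL
      concat := fun i t b x htb y hy z hz => (hH i).exists_concat hC hL htb hy hz
      exists_isCompact := fun R => ?_
      isClosed_rel := ?_
      rel_refl := ?_
      rel_trans := ?_
      eq_of_rel := fun _ _ h => h
      step_nonempty := fun G hne hG hbd a b x _ => ?_ }
  · obtain ⟨K, hK, hKS⟩ := exists_isCompact_solutionSet_subset (EuclideanSpace ℝ (Fin n)) hT hC L R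
    exact ⟨K, hK, fun i t x hx => hKS _ (hH i) t x hx⟩
  · rintro (_ | _ | _)
    · exact isClosed_eq continuous_fst continuous_snd
    · exact isClosed_le (continuous_fst.comp continuous_fst) (continuous_fst.comp continuous_snd)
    · exact isClosed_le (continuous_snd.comp continuous_fst) (continuous_snd.comp continuous_snd)
  · rintro (_ | _ | _) J
    exacts [rfl, le_refl J.1, le_refl J.2]
  · rintro (_ | _ | _) J₁ J₂ J₃ h h'
    exacts [Eq.trans h h', le_trans (a := J₁.1) h h', le_trans (a := J₁.2) h h']
  · obtain ⟨J, h0, h2, h1⟩ := exists_maximin_value hne hG hbd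
      (ContinuousEvalConst.continuous_eval_const (F := C(Icc (0 : ℝ) T, EuclideanSpace ℝ (Fin n))) b)
      (hcompact none a x) (fun u : P => hcompact (some (.inl u)) a x)
      (fun v : Q => hcompact (some (.inr v)) a x) (by
        intro u v
        -- A motion under the constant pair `(u, v)` is admissible for all three indices, which
        -- gives the required common point.
        obtain ⟨y, hy⟩ := ((hfam _ _ (isControlFamily_const u)
          (isControlFamily_const v)).solutionSet_nonempty (hT := hT) hC hL a x)
        have key : ∀ i ∈ ({none, some (.inl u), some (.inr v)} : Set (Option (P ⊕ Q))),
            y ∈ solutionSet hT (controlFields f g (firstControls i) (secondControls i)) a x := by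
          intro i hi
          refine solutionSet_mono ?_ a x hy
          rintro _ ⟨_, rfl, _, rfl, rfl⟩
          exact ⟨_, const_mem_firstControls u v i hi, _, const_mem_secondControls u v i hi, rfl⟩
        exact ⟨y, key _ (by simp), key _ (by simp), key _ (by simp)⟩)
    refine ⟨J, ?_⟩
    rintro (_ | u | v)
    · obtain ⟨y, hy, hJ⟩ := h0
      exact ⟨y, hy, J, hJ, rfl⟩
    · exact h2 u
    · exact h1 v

end Control

/-! ### The value multifunction of the game -/

/-- Existence of an upper semicontinuous value multifunction with nonempty values. Upper
semicontinuity is asserted in both usual senses: upper hemicontinuity and closedness of the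
graph. -/
theorem mainTheorem2 {n : ℕ} {P Q : Type*}
    [MetricSpace P] [CompactSpace P] [Nonempty P] [MeasurableSpace P] [BorelSpace P]
    [MetricSpace Q] [CompactSpace Q] [Nonempty Q] [MeasurableSpace Q] [BorelSpace Q]
    (T : ℝ) (hT : 0 ≤ T)
    (f : ℝ → EuclideanSpace ℝ (Fin n) → P → EuclideanSpace ℝ (Fin n))
    (g : ℝ → EuclideanSpace ℝ (Fin n) → Q → EuclideanSpace ℝ (Fin n))
    (hf : IsAdmissibleDynamics T f) (hg : IsAdmissibleDynamics T g)
    (σ₁ σ₂ : EuclideanSpace ℝ (Fin n) → ℝ) (hσ₁ : Continuous σ₁) (hσ₂ : Continuous σ₂) :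
    ∃ S : Set.Icc (0 : ℝ) T × EuclideanSpace ℝ (Fin n) → Set (ℝ × ℝ),
      (∀ p, (S p).Nonempty) ∧
      UpperHemicontinuous S ∧
      IsClosed {q : (Set.Icc (0 : ℝ) T × EuclideanSpace ℝ (Fin n)) × (ℝ × ℝ) | q.2 ∈ S q.1} ∧
      IsValueMultifunction T f g σ₁ σ₂ S := by
  have hsys := isViabilitySystem_game (P := P) (Q := Q) hf hg hT hσ₁ hσ₂
  obtain ⟨S, hne, hcl, hterm, hv⟩ := hsys.exists_viable
  have hsol : ∀ (i : Option (P ⊕ Q)) t x, solutionSet hT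
      (controlFields f g (firstControls i) (secondControls i)) t x = closure {y |
        ∃ u ∈ firstControls i, ∃ v ∈ secondControls i, IsMotion T f g t x u v y} := fun i t x =>
    solutionSet_controlFields hf hg hT (isControlFamily_firstControls i)
      (isControlFamily_secondControls i) t x
  refine ⟨S, hne, hsys.upperHemicontinuous hcl hterm fun t => hv t _ t.2.2, hcl,
    ⟨fun t x ht => ?_, fun t x J hJ u t' htt' => ?_, fun t x J hJ v t' htt' => ?_,
      fun t x J hJ t' htt' => ?_⟩⟩
  · rw [show t = ⟨T, hT, le_rfl⟩ from Subtype.ext ht]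
    exact hterm x
  · obtain ⟨y, hy, J', hJ', hr⟩ := hv t t' htt' (some (.inl u)) x J hJ
    refine ⟨y, ?_, J', hJ', hr⟩
    refine closure_mono ?_ ((hsol (some (.inl u)) t x).subset hy)
    rintro y ⟨_, rfl, v, hv, h⟩
    exact ⟨v, hv, h⟩
  · obtain ⟨y, hy, J', hJ', hr⟩ := hv t t' htt' (some (.inr v)) x J hJ
    refine ⟨y, ?_, J', hJ', hr⟩
    refine closure_mono ?_ ((hsol (some (.inr v)) t x).subset hy)
    rintro y ⟨u, hu, _, rfl, h⟩
    exact ⟨u, hu, h⟩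
  · obtain ⟨y, hy, J', hJ', hr⟩ := hv t t' htt' none x J hJ
    refine ⟨y, ?_, ?_⟩
    · refine closure_mono ?_ ((hsol none t x).subset hy)
      rintro y ⟨u, hu, v, hv, h⟩
      exact ⟨u, v, hu, hv, h⟩
    · rwa [show J' = J from hr] at hJ'
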